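/- Let $\mathscr G(n,c/n)$ be the random graph on $\{1,\dots,n\}$ in which each pair of nodes is joined independently with probability $c/n$. Let $V_n\subseteq\{1,\dots,n\}$ be a (deterministic) set of participants; the other nodes are hidden. A graph estimator $\widehat G_n$ is any function that takes the matrix $(d_{G}(i,j))_{i,j\in V_n}$ of exact shortest-path (hop) distances in $G$ between participants (equal to $\infty$ for participants in different components) to a finite graph whose nodes are the labeled nodes $V_n$ and any finite number of unlabeled hidden nodes; it may depend on $n$, $c$, $\delta$ and $V_n$. For two finite graphs $F,G$ that share the labeled nodes $V$, the edit distance is $$\Delta(F,G;V)=\min_\pi\|\mathbf A_F-\pi(\mathbf A_G)\|_1,$$ where the graph with fewer nodes is first padded with isolated unlabeled nodes so that both have the same number of nodes, $\mathbf A$ denotes the adjacency matrix, $\|\cdot\|_1$ is the sum of the absolute values of all entries, and $\pi$ runs over all rearrangements of the unlabeled nodes, with the labeled nodes kept fixed. Theorem. There is a constant $M>0$ such that the following holds for all constants $c>0$ and $\delta<0.5c-1$. Let $G_n\sim\mathscr G(n,c/n)$, let $(V_n)$ be any sequence of participant sets with $$|V_n|^2< M\,n\,(0.5c-\delta-1)\,\frac{\log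 n}{\log\log n}$$ for all sufficiently large $n$, and let $\widehat G_n$ be any graph estimators for $V_n$. Then $$\mathbb P\bigl[\Delta(\widehat G_n,G_n;V_n)>\delta n\bigr]\to 1\qquad(n\to\infty).$$ -/

import Mathlib

open Filter Topology MeasureTheory

namespace TopologyDiscovery

/-- Add `k` isolated unlabeled nodes to a graph whose nodes are the labeled nodes `L`
together with the unlabeled nodes `A`. -/
def padIsolated {L A : Type*} (F : SimpleGraph (L ⊕ A)) (k : ℕ) :
    SimpleGraph (L ⊕ (A ⊕ Fin k)) :=
  F.map (Function.Embedding.sumMap (Function.Embedding.refl L) Function.Embedding.inl)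

/-- The ways of matching the unlabeled nodes `A` of one graph with the unlabeled nodes `B` of
another one, after the graph with fewer unlabeled nodes has been padded by new unlabeled nodes so
that there are `max |A| |B|` of them on both sides (the truncated subtraction is intended). -/
abbrev Matching (A B : Type*) [Fintype A] [Fintype B] : Type _ :=
  (A ⊕ Fin (Fintype.card B - Fintype.card A)) ≃ (B ⊕ Fin (Fintype.card A - Fintype.card B))

instance {A B : Type*} [Fintype A] [Fintype B] : Nonempty (Matching A B) :=
  Fintype.card_eq.mp (by simp only [Fintype.card_sum, Fintype.card_fin]; omega)

open scoped Classical in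
/-- The entrywise `ℓ¹` distance between the adjacency matrix of (the padded) `F` and that of
(the padded) `G` with its unlabeled nodes rearranged by `π`; labeled nodes stay fixed. -/
noncomputable def matrixDiff {L A B : Type*} [Fintype L] [Fintype A] [Fintype B]
    (F : SimpleGraph (L ⊕ A)) (G : SimpleGraph (L ⊕ B)) (π : Matching A B) : ℝ :=
  ∑ x, ∑ y,
    |(padIsolated F (Fintype.card B - Fintype.card A)).adjMatrix ℝ x y -
      (padIsolated G (Fintype.card A - Fintype.card B)).adjMatrix ℝ
        (Equiv.sumCongr (Equiv.refl L) π x) (Equiv.sumCongr (Equiv.refl L) π y)|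

/-- The edit distance `Δ(F, G; L)` of two graphs with common labeled nodes `L` and unlabeled nodes
`A` and `B`: a minimum over the finite nonempty set of matchings of the unlabeled nodes. -/
noncomputable def editDist {L A B : Type*} [Fintype L] [Fintype A] [Fintype B]
    (F : SimpleGraph (L ⊕ A)) (G : SimpleGraph (L ⊕ B)) : ℝ :=
  ⨅ π : Matching A B, matrixDiff F G π

/-- A graph on `Fin n`, with its nodes split into the participants `V` (labeled) and the hidden
nodes (unlabeled). -/
def splitNodes {n : ℕ} (V : Finset (Fin n)) (G : SimpleGraph (Fin n)) :
    SimpleGraph ({x // x ∈ V} ⊕ {x // x ∉ V}) :=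
  G.comap (Equiv.sumCompl (fun x => x ∈ V))

/-- The exact shortest-path (hop) distances in `G` between the participants; the value is `⊤`
for participants in different components. -/
noncomputable def distances {n : ℕ} (V : Finset (Fin n)) (G : SimpleGraph (Fin n)) :
    {x // x ∈ V} → {x // x ∈ V} → ℕ∞ :=
  fun i j => G.edist i.1 j.1

/-- The possible outputs of a graph estimator: graphs on the participants and an arbitrary finite
number of hidden nodes. -/
abbrev Reconstruction {n : ℕ} (V : Finset (Fin n)) : Type :=
  Σ h : ℕ, SimpleGraph ({x // x ∈ V} ⊕ Fin h)

/-- A graph estimator with participants `V` is an arbitrary function of the matrix of pairwise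
distances between the participants. -/
abbrev Estimator {n : ℕ} (V : Finset (Fin n)) : Type :=
  ({x // x ∈ V} → {x // x ∈ V} → ℕ∞) → Reconstruction V

/-- The edit distance `Δ(Ĝ, G; V)` between the output of an estimator on the distances observed in
`G`, and `G` itself. -/
noncomputable def reconstructionError {n : ℕ} (V : Finset (Fin n)) (Ghat : Estimator V)
    (G : SimpleGraph (Fin n)) : ℝ :=
  editDist (Ghat (distances V G)).2 (splitNodes V G)

/-- The law `G(n, c/n)`. The edge probability is `c / n`, clamped to `[0, 1]`; for `c ≥ 0` the
clamping only concerns the finitely many `n < c`. -/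
noncomputable def sparseRandomGraph (c : ℝ) (n : ℕ) : Measure (SimpleGraph (Fin n)) :=
  SimpleGraph.binomialRandom (Fin n) (Set.projIcc (0 : ℝ) 1 zero_le_one (c / n))

end TopologyDiscovery

/-!
The edges of `G(n, c/n)` carry about `(c / 2) n log n` nats of information, and the distance matrix
of the participants carries too few to bring this below what an error of `δ n` allows for.

The case `δ < 0` is trivial, so `c > 2`. Put `η = c / 2 - δ - 1 > 0`.

* With high probability `G` has at least `(c / 2 - η / 4) n` edges
  (`tendsto_real_edges_lt`), so that a single such graph has probability at most
  `exp (-(c / 2 - η / 4 + o(1)) n log n)`.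
* A graph with `O(n)` edges within edit distance `δ n` of a given reconstruction is determined by the
  way its nodes are mapped to the `O(n)` nonisolated nodes of the reconstruction, and by the at most
  `δ n / 2` edges in which it then differs. This leaves `exp ((1 + δ + o(1)) n log n)` graphs
  (`card_graphs_near_reconstruction_le`).
* With high probability all finite distances are at most `K log n`
  (`exists_tendsto_edist_le_log`), so that there are at most
  `(K log n + 2) ^ |V| ^ 2 ≤ exp ((η / 4) n log n)` distance matrices, for `M = 1 / 8`.

A union bound over the distance matrices and the graphs near the corresponding estimates completes
the argument (`real_reconstructed_le`, `eventually_count_mul_exp_le`).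

The bound on the distances does not use branching processes. If every connected vertex set of size
between `O(log n)` and `d n` expands by a constant factor, then balls of radius `O(log n)`
in components of larger radius have linear size, and since such balls around equally spaced points of
a geodesic are disjoint, geodesics have length `O(log n)` (`Expands.edist_le`). Expansion holds by the
first moment method: the expected number of sets of `u` vertices that contain `u - 1` edges, and of
which all but a small fraction of vertices have no neighbor outside, is `O(n) ρ ^ u`, where `ρ` is
close to `(exp 2 * c / 2) * exp (-c)`, and this is less than `1` for all `c > 2`.
-/

namespace TopologyDiscovery

/-! ### Events of the binomial random graph -/

open scoped Classical in
/-- A product over all potential edges, summed over all graphs, factorizes. -/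
lemma sum_prod_edges {V : Type*} [Fintype V] (f g : Sym2 V → ℝ) :
    ∑ G : SimpleGraph V, ∏ e ∈ (⊤ : SimpleGraph V).edgeFinset,
      (if e ∈ G.edgeSet then f e else g e) =
    ∏ e ∈ (⊤ : SimpleGraph V).edgeFinset, (f e + g e) := by
  rw [Finset.prod_add]
  refine Finset.sum_bij' (fun G _ => G.edgeFinset)
    (fun t _ => SimpleGraph.fromEdgeSet (t : Set (Sym2 V)))
    ?_ ?_ ?_ ?_ ?_
  · intro G _
    rw [Finset.mem_powerset]
    exact SimpleGraph.edgeFinset_mono le_top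
  · intro t _
    exact Finset.mem_univ _
  · intro G _
    simp
  · intro t ht
    rw [Finset.mem_powerset] at ht
    ext e
    simp only [SimpleGraph.mem_edgeFinset, SimpleGraph.edgeSet_fromEdgeSet]
    constructor
    · intro h; exact h.1
    · intro h
      refine ⟨h, ?_⟩
      have := ht h
      rw [SimpleGraph.mem_edgeFinset] at this
      exact SimpleGraph.not_isDiag_of_mem_edgeSet _ this
  · intro G _
    have hsub : G.edgeFinset ⊆ (⊤ : SimpleGraph V).edgeFinset := SimpleGraph.edgeFinset_mono le_top
    rw [← Finset.prod_sdiff hsub, mul_comm]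
    congr 1
    · refine Finset.prod_congr rfl fun e he => ?_
      rw [if_pos (SimpleGraph.mem_edgeFinset.mp he)]
    · refine Finset.prod_congr rfl fun e he => ?_
      rw [if_neg (fun h => (Finset.mem_sdiff.mp he).2 (SimpleGraph.mem_edgeFinset.mpr h))]

open scoped Classical in
lemma binomialRandom_real_singleton {V : Type*} [Fintype V] (p : unitInterval)
    (G : SimpleGraph V) :
    (SimpleGraph.binomialRandom V p).real {G} =
      ∏ e ∈ (⊤ : SimpleGraph V).edgeFinset,
        (if e ∈ G.edgeSet then (p : ℝ) else 1 - (p : ℝ)) := by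
  have hsub : G.edgeFinset ⊆ (⊤ : SimpleGraph V).edgeFinset := SimpleGraph.edgeFinset_mono le_top
  rw [measureReal_def, SimpleGraph.binomialRandom_singleton, ← Finset.prod_sdiff hsub, mul_comm,
    Finset.prod_congr rfl (g := fun _ => 1 - (p : ℝ)) (fun e he => if_neg (fun h =>
      (Finset.mem_sdiff.mp he).2 (SimpleGraph.mem_edgeFinset.mpr h))),
    Finset.prod_congr (s₁ := G.edgeFinset) rfl (g := fun _ => (p : ℝ)) (fun e he =>
      if_pos (SimpleGraph.mem_edgeFinset.mp he)), Finset.prod_const, Finset.prod_const,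
    Finset.card_sdiff_of_subset hsub, SimpleGraph.card_edgeFinset_top_eq_card_choose_two]
  simp [Set.ncard_eq_toFinset_card', Nat.card_eq_fintype_card, SimpleGraph.edgeFinset]

lemma binomialRandom_real_le_sum {V : Type*} [Fintype V] (p : unitInterval)
    (A : Finset (SimpleGraph V)) :
    (SimpleGraph.binomialRandom V p).real (A : Set (SimpleGraph V)) ≤
      ∑ G ∈ A, (SimpleGraph.binomialRandom V p).real {G} := by
  have := measureReal_biUnion_finset_le (μ := SimpleGraph.binomialRandom V p) A
    (fun G => ({G} : Set (SimpleGraph V)))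
  rwa [show (⋃ G ∈ A, ({G} : Set (SimpleGraph V))) = A by ext; simp] at this

open scoped Classical in
/-- Markov's inequality for a random variable that is a product over the potential edges. -/
lemma binomialRandom_markov {V : Type*} [Fintype V] (p : unitInterval)
    (A : Set (SimpleGraph V)) (a b : Sym2 V → ℝ) (ha : ∀ e, 0 ≤ a e) (hb : ∀ e, 0 ≤ b e)
    (t : ℝ) (ht : 0 ≤ t)
    (hA : ∀ G ∈ A, t ≤ ∏ e ∈ (⊤ : SimpleGraph V).edgeFinset,
      (if e ∈ G.edgeSet then a e else b e)) :
    t * (SimpleGraph.binomialRandom V p).real A ≤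
      ∏ e ∈ (⊤ : SimpleGraph V).edgeFinset, ((p : ℝ) * a e + (1 - (p : ℝ)) * b e) := by
  have hp0 : 0 ≤ (p : ℝ) := p.2.1
  have hp1 : 0 ≤ 1 - (p : ℝ) := sub_nonneg.mpr p.2.2
  have h1 := binomialRandom_real_le_sum p (Finset.univ.filter (· ∈ A))
  rw [show ((Finset.univ.filter (· ∈ A) : Finset (SimpleGraph V)) : Set (SimpleGraph V)) = A by
    ext; simp] at h1
  rw [← sum_prod_edges]
  refine (mul_le_mul_of_nonneg_left h1 ht).trans ?_
  rw [Finset.mul_sum]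
  have key : ∀ G : SimpleGraph V, (SimpleGraph.binomialRandom V p).real {G} *
      (∏ e ∈ (⊤ : SimpleGraph V).edgeFinset, (if e ∈ G.edgeSet then a e else b e)) =
      ∏ e ∈ (⊤ : SimpleGraph V).edgeFinset,
        (if e ∈ G.edgeSet then (p : ℝ) * a e else (1 - (p : ℝ)) * b e) := by
    intro G
    rw [binomialRandom_real_singleton, ← Finset.prod_mul_distrib]
    refine Finset.prod_congr rfl fun e _ => ?_
    split_ifs <;> rfl
  calc ∑ G ∈ Finset.univ.filter (· ∈ A), t * (SimpleGraph.binomialRandom V p).real {G}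
      ≤ ∑ G ∈ Finset.univ.filter (· ∈ A), ∏ e ∈ (⊤ : SimpleGraph V).edgeFinset,
        (if e ∈ G.edgeSet then (p : ℝ) * a e else (1 - (p : ℝ)) * b e) := by
        refine Finset.sum_le_sum fun G hG => ?_
        rw [← key, mul_comm]
        exact mul_le_mul_of_nonneg_left (hA G (Finset.mem_filter.mp hG).2) measureReal_nonneg
    _ ≤ _ := by
        refine Finset.sum_le_sum_of_subset_of_nonneg (Finset.filter_subset _ _) fun G _ _ => ?_
        refine Finset.prod_nonneg fun e _ => ?_
        split_ifs
        · exact mul_nonneg hp0 (ha e)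
        · exact mul_nonneg hp1 (hb e)

/-- Prescribing the presence of the edges in `F` and the absence of those in `C` is Markov's
inequality with the indicators of these events as weights. -/
lemma binomialRandom_real_present_absent {V : Type*} [Fintype V] [DecidableEq V]
    (p : unitInterval) (F C : Finset (Sym2 V))
    (hF : F ⊆ (⊤ : SimpleGraph V).edgeFinset) (hC : C ⊆ (⊤ : SimpleGraph V).edgeFinset)
    (hFC : Disjoint F C) :
    (SimpleGraph.binomialRandom V p).real
      {G | (∀ e ∈ F, e ∈ G.edgeSet) ∧ ∀ e ∈ C, e ∉ G.edgeSet} ≤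
      (p : ℝ) ^ F.card * (1 - (p : ℝ)) ^ C.card := by
  classical
  have h := binomialRandom_markov p
    {G | (∀ e ∈ F, e ∈ G.edgeSet) ∧ ∀ e ∈ C, e ∉ G.edgeSet}
    (fun e => if e ∈ C then 0 else 1) (fun e => if e ∈ F then 0 else 1)
    (fun e => by split_ifs <;> norm_num)
    (fun e => by split_ifs <;> norm_num) 1 zero_le_one ?_
  · rw [one_mul] at h
    refine h.trans (le_of_eq ?_)
    have h2 : ∀ e ∈ (⊤ : SimpleGraph V).edgeFinset,
        ((p : ℝ) * (if e ∈ C then 0 else 1) + (1 - (p : ℝ)) * (if e ∈ F then 0 else 1)) =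
        (if e ∈ F then (p : ℝ) else 1) * (if e ∈ C then (1 - (p : ℝ)) else 1) := by
      intro e _
      by_cases h1 : e ∈ F
      · have h3 : e ∉ C := fun h3 => Finset.disjoint_left.mp hFC h1 h3
        simp [h1, h3]
      · by_cases h3 : e ∈ C <;> simp [h1, h3]
    convert (Finset.prod_congr rfl h2).trans ?_
    rw [Finset.prod_mul_distrib, Finset.prod_ite_mem, Finset.prod_ite_mem,
      Finset.inter_eq_right.mpr hF, Finset.inter_eq_right.mpr hC, Finset.prod_const,
      Finset.prod_const]
  · rintro G ⟨h1, h2⟩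
    refine le_of_eq (Finset.prod_eq_one fun e _ => ?_).symm
    by_cases he : e ∈ G.edgeSet
    · have : e ∉ C := fun h => h2 e h he
      simp [he, this]
    · have : e ∉ F := fun h => he (h1 e h)
      simp [he, this]

/-- Exponential Markov inequality for the number of edges. -/
lemma binomialRandom_real_edges_markov {V : Type*} [Fintype V] (p : unitInterval)
    (A : Set (SimpleGraph V)) (x t : ℝ) (hx : 0 ≤ x) (ht : 0 ≤ t)
    (hA : ∀ G ∈ A, t ≤ x ^ G.edgeSet.ncard) :
    t * (SimpleGraph.binomialRandom V p).real A ≤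
      (1 + (p : ℝ) * (x - 1)) ^ ((Fintype.card V).choose 2) := by
  classical
  have h := binomialRandom_markov p A (fun _ => x) (fun _ => 1) (fun _ => hx)
    (fun _ => zero_le_one) t ht ?_
  · refine h.trans (le_of_eq ?_)
    rw [Finset.prod_const, SimpleGraph.card_edgeFinset_top_eq_card_choose_two]
    congr 1
    ring
  · intro G hG
    refine (hA G hG).trans (le_of_eq ?_)
    rw [← Finset.prod_filter, Finset.prod_const]
    congr 1
    rw [Set.ncard_eq_toFinset_card']
    congr 1
    ext e
    simp only [Set.mem_toFinset, Finset.mem_filter, SimpleGraph.mem_edgeFinset]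
    exact ⟨fun h => ⟨SimpleGraph.edgeSet_mono le_top h, h⟩, fun h => h.2⟩

lemma binomialRandom_real_singleton_le {V : Type*} [Fintype V] (p : unitInterval)
    (G : SimpleGraph V) :
    (SimpleGraph.binomialRandom V p).real {G} ≤ (p : ℝ) ^ G.edgeSet.ncard := by
  classical
  have hsub : G.edgeFinset ⊆ (⊤ : SimpleGraph V).edgeFinset := SimpleGraph.edgeFinset_mono le_top
  have h := binomialRandom_real_present_absent p G.edgeFinset ∅ hsub (by simp) (by simp)
  refine (measureReal_mono ?_).trans (h.trans (le_of_eq ?_))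
  · rintro _ rfl
    simp
  · simp [Set.ncard_eq_toFinset_card', SimpleGraph.edgeFinset]

/-! ### Expansion bounds distances -/

/-- The vertices within distance `k` of `v`. -/
noncomputable def closedBall {V : Type*} [Fintype V] (G : SimpleGraph V) (v : V) (k : ℕ) :
    Finset V :=
  open scoped Classical in Finset.univ.filter fun x => G.edist v x ≤ k

/-- Vertex expansion of the connected vertex sets whose size lies between `u₀` and `m`: if `S ⊆ U`
has all its neighbors in such a set `U`, then `S` is smaller than `U` by a factor `q`. -/
def Expands {V : Type*} (G : SimpleGraph V) (u₀ m : ℕ) (q : ℝ) : Prop :=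
  ∀ U S : Finset V, S ⊆ U → (G.induce (U : Set V)).Connected → u₀ ≤ U.card → U.card ≤ m →
    (∀ x ∈ S, ∀ y ∉ U, ¬ G.Adj x y) → (S.card : ℝ) < q * U.card

lemma edist_getVert_le {V : Type*} {G : SimpleGraph V} {x y : V} (w : G.Walk x y)
    (i d : ℕ) (h : i + d ≤ w.length) :
    G.edist (w.getVert i) (w.getVert (i + d)) ≤ d := by
  induction d with
  | zero => simp
  | succ d ih =>
    have h1 := w.adj_getVert_succ (i := i + d) (by omega)
    have h2 : G.edist (w.getVert (i + d)) (w.getVert (i + d + 1)) ≤ 1 :=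
      SimpleGraph.edist_le_one_iff_adj_or_eq.mpr (Or.inl h1)
    calc G.edist (w.getVert i) (w.getVert (i + (d + 1)))
        ≤ G.edist (w.getVert i) (w.getVert (i + d)) +
          G.edist (w.getVert (i + d)) (w.getVert (i + d + 1)) := SimpleGraph.edist_triangle
      _ ≤ d + 1 := add_le_add (ih (by omega)) h2
      _ = ((d + 1 : ℕ) : ℕ∞) := by push_cast; rfl

lemma exists_geodesic {V : Type*} {G : SimpleGraph V} {x y : V} {L : ℕ}
    (h : G.edist x y = L) :
    ∃ z : ℕ → V, z 0 = x ∧ ∀ i d, i + d ≤ L → G.edist (z i) (z (i + d)) = d := by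
  obtain ⟨w, hw⟩ := SimpleGraph.exists_walk_of_edist_eq_coe h
  refine ⟨w.getVert, by simp, fun i d hid => le_antisymm (edist_getVert_le w i d (by omega)) ?_⟩
  have h1 := edist_getVert_le w 0 i (by omega)
  have h2 := edist_getVert_le w (i + d) (L - (i + d)) (by omega)
  rw [show i + d + (L - (i + d)) = w.length by omega] at h2
  simp only [zero_add, SimpleGraph.Walk.getVert_zero, SimpleGraph.Walk.getVert_length] at h1 h2
  have h3 : (L : ℕ∞) ≤ i + (G.edist (w.getVert i) (w.getVert (i + d)) +
      ((L - (i + d) : ℕ) : ℕ∞)) := by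
    rw [← h]
    exact SimpleGraph.edist_triangle.trans (add_le_add h1
      (SimpleGraph.edist_triangle.trans (add_le_add le_rfl h2)))
  have h4 := edist_getVert_le w i d (by omega)
  have h5 : G.edist (w.getVert i) (w.getVert (i + d)) ≠ ⊤ :=
    ne_top_of_le_ne_top (ENat.natCast_ne_top _) h4
  lift G.edist (w.getVert i) (w.getVert (i + d)) to ℕ using h5 with e
  norm_cast at h3 ⊢
  omega

section

variable {V : Type*} [Fintype V] {G : SimpleGraph V}

lemma mem_closedBall {v x : V} {k : ℕ} : x ∈ closedBall G v k ↔ G.edist v x ≤ k := by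
  simp [closedBall]

lemma closedBall_mono (v : V) {k l : ℕ} (h : k ≤ l) : closedBall G v k ⊆ closedBall G v l := by
  intro x hx
  rw [mem_closedBall] at hx ⊢
  exact hx.trans (by exact_mod_cast h)

lemma card_closedBall_of_edist {x y : V} {L k : ℕ} (h : G.edist x y = L) (hk : k ≤ L) :
    k + 1 ≤ (closedBall G x k).card := by
  obtain ⟨z, hz0, hz⟩ := exists_geodesic h
  have hinj : Set.InjOn z (Finset.range (k + 1) : Set ℕ) := by
    intro i hi j hj hij
    simp only [Finset.coe_range, Set.mem_Iio] at hi hj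
    have h1 := hz 0 i (by omega)
    have h2 := hz 0 j (by omega)
    rw [zero_add] at h1 h2
    rw [hij, h2] at h1
    exact_mod_cast h1.symm
  calc k + 1 = (Finset.range (k + 1)).card := by simp
    _ ≤ _ := Finset.card_le_card_of_injOn z (fun i hi => ?_) hinj
  simp only [Finset.coe_range, Set.mem_Iio] at hi
  have h1 := hz 0 i (by omega)
  rw [zero_add, hz0] at h1
  rw [Finset.mem_coe, mem_closedBall, h1]
  exact_mod_cast (by omega)

lemma connected_induce_closedBall (v : V) (k : ℕ) :
    (G.induce (closedBall G v k : Set V)).Connected := by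
  refine SimpleGraph.induce_connected_of_patches v (by simp [mem_closedBall]) ?_
  intro x hx
  rw [Finset.mem_coe, mem_closedBall] at hx
  obtain ⟨w, hw⟩ := SimpleGraph.exists_walk_of_edist_ne_top
    (ne_top_of_le_ne_top (ENat.natCast_ne_top _) hx)
  refine ⟨{y | y ∈ w.support}, ?_, w.start_mem_support, w.end_mem_support,
    w.connected_induce_support _ _⟩
  intro y hy
  obtain ⟨i, rfl, hi⟩ := SimpleGraph.Walk.mem_support_iff_exists_getVert.mp hy
  rw [Finset.mem_coe, mem_closedBall]
  have h1 := edist_getVert_le w 0 i (by omega)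
  simp only [zero_add, SimpleGraph.Walk.getVert_zero] at h1
  refine h1.trans (le_trans ?_ hx)
  rw [← hw]
  exact_mod_cast hi

/-- Once a ball has size at least `u₀`, expansion makes it grow by a factor `1 / q` with each unit
of its radius, until it has more than `m` vertices. -/
lemma Expands.lt_card_closedBall {u₀ m J : ℕ} {q : ℝ} (hG : Expands G u₀ m q) (hq : 0 < q)
    (hJ : q ^ J * m < 1) {x y : V} {L : ℕ} (h : G.edist x y = L) (hL : u₀ ≤ L) :
    m < (closedBall G x (u₀ + J)).card := by
  have key : ∀ j, (closedBall G x (u₀ + j)).card ≤ m →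
      1 ≤ q ^ j * ((closedBall G x (u₀ + j)).card : ℝ) := by
    intro j
    induction j with
    | zero =>
      intro _
      have := card_closedBall_of_edist h hL
      rw [pow_zero, one_mul, add_zero]
      exact_mod_cast (by omega)
    | succ j ih =>
      intro hm
      have hsub : closedBall G x (u₀ + j) ⊆ closedBall G x (u₀ + (j + 1)) :=
        closedBall_mono x (by omega)
      have h1 := ih ((Finset.card_le_card hsub).trans hm)
      have h2 := hG _ _ hsub (connected_induce_closedBall x _)
        (by
          have := card_closedBall_of_edist h hL
          have h3 := Finset.card_le_card (closedBall_mono (G := G) x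
            (show u₀ ≤ u₀ + (j + 1) by omega))
          omega) hm ?_
      · calc 1 ≤ q ^ j * ((closedBall G x (u₀ + j)).card : ℝ) := h1
          _ ≤ q ^ j * (q * ((closedBall G x (u₀ + (j + 1))).card : ℝ)) := by gcongr
          _ = _ := by ring
      · intro a ha b hb hab
        apply hb
        rw [mem_closedBall] at ha ⊢
        calc G.edist x b ≤ G.edist x a + G.edist a b := SimpleGraph.edist_triangle
          _ ≤ ((u₀ + j : ℕ) : ℕ∞) + 1 :=
            add_le_add ha (SimpleGraph.edist_le_one_iff_adj_or_eq.mpr (Or.inl hab))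
          _ = _ := by push_cast; ring
  by_contra hlt
  push Not at hlt
  have h1 := key J hlt
  have h2 : q ^ J * ((closedBall G x (u₀ + J)).card : ℝ) ≤ q ^ J * m := by gcongr
  linarith

/-- Expansion bounds all finite distances: equally spaced points of a long geodesic have disjoint
balls with more than `m` vertices each. -/
lemma Expands.edist_le {u₀ m J T : ℕ} {q : ℝ} (hG : Expands G u₀ m q) (hq : 0 < q)
    (hJ : q ^ J * m < 1) (hT : Fintype.card V < (T + 1) * (m + 1)) {x y : V}
    (h : G.edist x y ≠ ⊤) : G.edist x y ≤ ((T + 1) * (2 * (u₀ + J) + 1) : ℕ) := by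
  classical
  by_contra hlt
  push Not at hlt
  obtain ⟨L, hL⟩ := ENat.ne_top_iff_exists.mp h
  rw [← hL] at hlt
  have hlt' : (T + 1) * (2 * (u₀ + J) + 1) < L := by exact_mod_cast hlt
  obtain ⟨z, -, hz⟩ := exists_geodesic hL.symm
  set R := 2 * (u₀ + J) + 1 with hR
  have hbig : ∀ i ∈ Finset.range (T + 1), m + 1 ≤ (closedBall G (z (i * R)) (u₀ + J)).card := by
    intro i hi
    rw [Finset.mem_range] at hi
    have h1 : i * R + R ≤ (T + 1) * R := by nlinarith
    exact hG.lt_card_closedBall hq hJ (hz (i * R) R (by omega)) (by omega)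
  have hdisj : ∀ i ∈ Finset.range (T + 1), ∀ j ∈ Finset.range (T + 1), i < j →
      Disjoint (closedBall G (z (i * R)) (u₀ + J)) (closedBall G (z (j * R)) (u₀ + J)) := by
    intro i hi j hj hij
    rw [Finset.disjoint_left]
    intro a ha hb
    rw [Finset.mem_range] at hi hj
    rw [mem_closedBall] at ha hb
    obtain ⟨d, rfl⟩ := Nat.exists_eq_add_of_lt hij
    have h1 : (i + d + 1) * R ≤ (T + 1) * R := Nat.mul_le_mul_right _ (by omega)
    have h2 := hz (i * R) ((d + 1) * R) (by nlinarith)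
    rw [show i * R + (d + 1) * R = (i + d + 1) * R by ring] at h2
    have h3 : (((d + 1) * R : ℕ) : ℕ∞) ≤ ((u₀ + J : ℕ) : ℕ∞) + ((u₀ + J : ℕ) : ℕ∞) := by
      rw [← h2]
      rw [SimpleGraph.edist_comm] at hb
      exact SimpleGraph.edist_triangle.trans (add_le_add ha hb)
    have h4 : (d + 1) * R ≤ (u₀ + J) + (u₀ + J) := by exact_mod_cast h3
    nlinarith
  have hcard : (T + 1) * (m + 1) ≤ Fintype.card V := by
    calc (T + 1) * (m + 1) = ∑ i ∈ Finset.range (T + 1), (m + 1) := by simp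
      _ ≤ ∑ i ∈ Finset.range (T + 1), (closedBall G (z (i * R)) (u₀ + J)).card :=
        Finset.sum_le_sum hbig
      _ = ((Finset.range (T + 1)).biUnion fun i => closedBall G (z (i * R)) (u₀ + J)).card := by
        rw [Finset.card_biUnion]
        intro i hi j hj hij
        rcases lt_or_gt_of_ne hij with h | h
        · exact hdisj i hi j hj h
        · exact (hdisj j hj i hi h).symm
      _ ≤ _ := Finset.card_le_univ _
  omega

end

/-! ### The first moment of nonexpanding sets -/

/-- The pairs of distinct vertices of `U`. -/
noncomputable def pairsWithin {V : Type*} (U : Finset V) : Finset (Sym2 V) :=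
  open scoped Classical in U.offDiag.image fun x => s(x.1, x.2)

/-- The pairs that join a vertex of `S` to a vertex outside of `U`. -/
noncomputable def pairsAcross {V : Type*} [Fintype V] (S U : Finset V) : Finset (Sym2 V) :=
  open scoped Classical in (S ×ˢ Uᶜ).image fun x => s(x.1, x.2)

lemma card_pairsWithin {V : Type*} (U : Finset V) :
    (pairsWithin U).card = U.card.choose 2 := by
  classical
  have := Sym2.card_image_offDiag U
  unfold pairsWithin
  convert this using 2
  rfl

lemma card_pairsAcross {V : Type*} [Fintype V] {S U : Finset V} (hSU : S ⊆ U) :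
    (pairsAcross S U).card = S.card * (Fintype.card V - U.card) := by
  classical
  unfold pairsAcross
  rw [Finset.card_image_of_injOn, Finset.card_product, Finset.card_compl]
  rintro ⟨a, b⟩ hab ⟨a', b'⟩ hab' h
  simp only [Finset.coe_product, Set.mem_prod, Finset.mem_coe, Finset.mem_compl] at hab hab'
  rcases Sym2.eq_iff.mp h with ⟨h1, h2⟩ | ⟨h1, h2⟩
  · exact Prod.ext h1 h2
  · exact absurd (hSU hab'.1) (by rw [← show b = a' from h2]; exact hab.2)

lemma pairsWithin_subset {V : Type*} [Fintype V] [DecidableEq V] (U : Finset V) :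
    pairsWithin U ⊆ (⊤ : SimpleGraph V).edgeFinset := by
  intro e he
  simp only [pairsWithin, Finset.mem_image, Finset.mem_offDiag] at he
  obtain ⟨x, hx, rfl⟩ := he
  simpa using hx.2.2

lemma pairsAcross_subset {V : Type*} [Fintype V] [DecidableEq V] {S U : Finset V} (hSU : S ⊆ U) :
    pairsAcross S U ⊆ (⊤ : SimpleGraph V).edgeFinset := by
  intro e he
  simp only [pairsAcross, Finset.mem_image, Finset.mem_product, Finset.mem_compl] at he
  obtain ⟨x, hx, rfl⟩ := he
  simp only [SimpleGraph.mem_edgeFinset, SimpleGraph.mem_edgeSet, SimpleGraph.top_adj]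
  intro h
  exact hx.2 (h ▸ hSU hx.1)

lemma disjoint_pairsWithin_pairsAcross {V : Type*} [Fintype V] (S U : Finset V) :
    Disjoint (pairsWithin U) (pairsAcross S U) := by
  rw [Finset.disjoint_left]
  intro e he he'
  simp only [pairsWithin, Finset.mem_image, Finset.mem_offDiag] at he
  simp only [pairsAcross, Finset.mem_image, Finset.mem_product, Finset.mem_compl] at he'
  obtain ⟨x, hx, rfl⟩ := he
  obtain ⟨y, hy, h⟩ := he'
  rcases Sym2.eq_iff.mp h with ⟨h1, h2⟩ | ⟨h1, h2⟩
  · exact hy.2 (h2 ▸ hx.2.1)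
  · exact hy.2 (h2 ▸ hx.1)

/-- A connected induced subgraph contains as many edges as a spanning tree. -/
lemma exists_edges_of_connected {V : Type*} {G : SimpleGraph V} {U : Finset V}
    (h : (G.induce (U : Set V)).Connected) :
    ∃ F ∈ (pairsWithin U).powersetCard (U.card - 1), ∀ e ∈ F, e ∈ G.edgeSet := by
  classical
  have h1 := h.card_vert_le_card_edgeSet_add_one
  set E := (G.induce (U : Set V)).edgeFinset.image (Sym2.map Subtype.val) with hE
  have hcard : U.card - 1 ≤ E.card := by
    rw [hE, Finset.card_image_of_injective _ (Sym2.map.injective Subtype.val_injective)]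
    rw [Nat.card_eq_fintype_card, Nat.card_eq_fintype_card, ← SimpleGraph.edgeFinset_card] at h1
    simp only [Finset.coe_sort_coe, Fintype.card_coe] at h1
    omega
  obtain ⟨F, hFE, hF⟩ := Finset.exists_subset_card_eq hcard
  have hmem : ∀ e ∈ F, e ∈ pairsWithin U ∧ e ∈ G.edgeSet := by
    intro e he
    have := hFE he
    rw [hE, Finset.mem_image] at this
    obtain ⟨e', he', rfl⟩ := this
    induction e' using Sym2.ind with
    | _ x y =>
      simp only [SimpleGraph.mem_edgeFinset, SimpleGraph.mem_edgeSet, SimpleGraph.comap_adj] at he'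
      have he'' : G.Adj x.1 y.1 := he'
      refine ⟨?_, he''⟩
      simp only [pairsWithin, Finset.mem_image, Finset.mem_offDiag]
      exact ⟨(x.1, y.1), ⟨x.2, y.2, he''.ne⟩, rfl⟩
  exact ⟨F, Finset.mem_powersetCard.mpr ⟨fun e he => (hmem e he).1, hF⟩, fun e he => (hmem e he).2⟩

/-- The subsets that make up at least a fraction `q` of `U`, weighted by `a` per element. The
parameter `l` is that of an exponential Markov inequality for the number of missing elements. -/
lemma sum_pow_card_le {V : Type*} [DecidableEq V] (U : Finset V) (a q l : ℝ) (ha : 0 ≤ a)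
    (hl : 0 ≤ l) :
    ∑ S ∈ U.powerset.filter (fun S => q * U.card ≤ (S.card : ℝ)), a ^ S.card ≤
      (Real.exp (l * (1 - q)) * (a + Real.exp (-l))) ^ U.card := by
  rw [mul_pow, ← Finset.sum_pow_mul_eq_add_pow, Finset.mul_sum]
  refine (Finset.sum_le_sum (fun S hS => ?_)).trans
    (Finset.sum_le_sum_of_subset_of_nonneg (Finset.filter_subset _ _) fun S _ _ => by positivity)
  rw [Finset.mem_filter, Finset.mem_powerset] at hS
  have hle := Finset.card_le_card hS.1
  rw [← Real.exp_nat_mul, ← Real.exp_nat_mul, mul_left_comm, ← Real.exp_add]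
  refine le_mul_of_one_le_right (by positivity) (Real.one_le_exp ?_)
  push_cast [Nat.cast_sub hle]
  nlinarith [hS.2]

/-- For a fixed vertex set `U`: a union bound over the edges of a spanning tree and over the set
of vertices without neighbors outside of `U`. -/
lemma binomialRandom_real_not_expands_le {V : Type*} [Fintype V] (p : unitInterval) (U : Finset V)
    (q l : ℝ) (hl : 0 ≤ l) :
    (SimpleGraph.binomialRandom V p).real {G | (G.induce (U : Set V)).Connected ∧
      ∃ S ⊆ U, q * U.card ≤ (S.card : ℝ) ∧ ∀ x ∈ S, ∀ y ∉ U, ¬ G.Adj x y} ≤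
    ((U.card.choose 2).choose (U.card - 1) : ℝ) * (p : ℝ) ^ (U.card - 1) *
      (Real.exp (l * (1 - q)) *
        ((1 - (p : ℝ)) ^ (Fintype.card V - U.card) + Real.exp (-l))) ^ U.card := by
  classical
  have hp1 : 0 ≤ 1 - (p : ℝ) := sub_nonneg.mpr p.2.2
  set I := (pairsWithin U).powersetCard (U.card - 1) ×ˢ
    U.powerset.filter (fun S => q * U.card ≤ (S.card : ℝ)) with hI
  have hsub : {G : SimpleGraph V | (G.induce (U : Set V)).Connected ∧
      ∃ S ⊆ U, q * U.card ≤ (S.card : ℝ) ∧ ∀ x ∈ S, ∀ y ∉ U, ¬ G.Adj x y} ⊆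
      ⋃ i ∈ I, {G | (∀ e ∈ i.1, e ∈ G.edgeSet) ∧ ∀ e ∈ pairsAcross i.2 U, e ∉ G.edgeSet} := by
    rintro G ⟨hconn, S, hSU, hS, hno⟩
    obtain ⟨F, hF, hFG⟩ := exists_edges_of_connected hconn
    simp only [Set.mem_iUnion]
    refine ⟨(F, S), ?_, hFG, ?_⟩
    · rw [hI, Finset.mem_product, Finset.mem_filter, Finset.mem_powerset]
      exact ⟨hF, hSU, hS⟩
    · intro e he
      simp only [pairsAcross, Finset.mem_image, Finset.mem_product, Finset.mem_compl] at he
      obtain ⟨x, hx, rfl⟩ := he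
      exact hno _ hx.1 _ hx.2
  refine (measureReal_mono hsub (measure_ne_top _ _)).trans ((measureReal_biUnion_finset_le _ _).trans ?_)
  calc ∑ i ∈ I, (SimpleGraph.binomialRandom V p).real
        {G | (∀ e ∈ i.1, e ∈ G.edgeSet) ∧ ∀ e ∈ pairsAcross i.2 U, e ∉ G.edgeSet}
      ≤ ∑ i ∈ I, (p : ℝ) ^ (U.card - 1) *
          ((1 - (p : ℝ)) ^ (Fintype.card V - U.card)) ^ i.2.card := by
        refine Finset.sum_le_sum fun i hi => ?_
        rw [hI, Finset.mem_product, Finset.mem_filter, Finset.mem_powerset,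
          Finset.mem_powersetCard] at hi
        have h := binomialRandom_real_present_absent p i.1 (pairsAcross i.2 U)
          (hi.1.1.trans (pairsWithin_subset U)) (pairsAcross_subset hi.2.1)
          (Finset.disjoint_of_subset_left hi.1.1 (disjoint_pairsWithin_pairsAcross i.2 U))
        rwa [hi.1.2, card_pairsAcross hi.2.1, mul_comm i.2.card, pow_mul] at h
    _ = ((U.card.choose 2).choose (U.card - 1) : ℝ) * (p : ℝ) ^ (U.card - 1) *
          ∑ S ∈ U.powerset.filter (fun S => q * U.card ≤ (S.card : ℝ)),
            ((1 - (p : ℝ)) ^ (Fintype.card V - U.card)) ^ S.card := by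
        rw [hI, Finset.sum_product]
        simp only [← Finset.mul_sum]
        rw [Finset.sum_const, Finset.card_powersetCard, card_pairsWithin, nsmul_eq_mul]
        ring
    _ ≤ _ := by
        have hp0 : 0 ≤ (p : ℝ) := p.2.1
        gcongr
        exact sum_pow_card_le U _ q l (by positivity) hl

/-- The first moment bound for the failure of expansion. -/
lemma binomialRandom_real_not_expands_le_sum {V : Type*} [Fintype V] (p : unitInterval) (u₀ m : ℕ)
    (q l : ℝ) (hl : 0 ≤ l) :
    (SimpleGraph.binomialRandom V p).real {G | ¬ Expands G u₀ m q} ≤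
    ∑ u ∈ Finset.Icc u₀ m, ((Fintype.card V).choose u : ℝ) *
      (((u.choose 2).choose (u - 1) : ℝ) * (p : ℝ) ^ (u - 1) *
      (Real.exp (l * (1 - q)) *
        ((1 - (p : ℝ)) ^ (Fintype.card V - u) + Real.exp (-l))) ^ u) := by
  classical
  have hsub : {G : SimpleGraph V | ¬ Expands G u₀ m q} ⊆
      ⋃ u ∈ Finset.Icc u₀ m, ⋃ U ∈ (Finset.univ : Finset V).powersetCard u,
      {G | (G.induce (U : Set V)).Connected ∧
      ∃ S ⊆ U, q * U.card ≤ (S.card : ℝ) ∧ ∀ x ∈ S, ∀ y ∉ U, ¬ G.Adj x y} := by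
    intro G hG
    simp only [Expands, Set.mem_ofPred_eq] at hG
    push Not at hG
    obtain ⟨U, S, hSU, hconn, h0, hm, hno, hS⟩ := hG
    simp only [Set.mem_iUnion]
    exact ⟨U.card, Finset.mem_Icc.mpr ⟨h0, hm⟩, U, by simp, hconn, S, hSU, hS, hno⟩
  refine (measureReal_mono hsub (measure_ne_top _ _)).trans ((measureReal_biUnion_finset_le _ _).trans ?_)
  refine Finset.sum_le_sum fun u _ => (measureReal_biUnion_finset_le _ _).trans ?_
  calc _ ≤ ∑ U ∈ (Finset.univ : Finset V).powersetCard u,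
      (((u.choose 2).choose (u - 1) : ℝ) * (p : ℝ) ^ (u - 1) *
      (Real.exp (l * (1 - q)) *
        ((1 - (p : ℝ)) ^ (Fintype.card V - u) + Real.exp (-l))) ^ u) := by
        refine Finset.sum_le_sum fun U hU => ?_
        obtain rfl := (Finset.mem_powersetCard.mp hU).2
        exact binomialRandom_real_not_expands_le p U q l hl
    _ = _ := by
        rw [Finset.sum_const, Finset.card_powersetCard, Finset.card_univ, nsmul_eq_mul]

/-! ### Distances and number of edges in `G(n, c/n)` -/

/-- Both binomial coefficients are bounded by a power over `u !`, and then `u ^ u / u ! ≤ exp u`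
is used twice. -/
lemma choose_mul_choose_le {n u : ℕ} (hu : 1 ≤ u) :
    (n.choose u : ℝ) * ((u.choose 2).choose (u - 1) : ℝ) ≤
      2 * (n : ℝ) ^ u * (Real.exp 2 / 2) ^ u := by
  obtain ⟨k, rfl⟩ : ∃ k, u = k + 1 := ⟨u - 1, by omega⟩
  set u := k + 1 with hu'
  have hfac : (0 : ℝ) < (u.factorial : ℝ) := by positivity
  have h1 : (n.choose u : ℝ) ≤ (n : ℝ) ^ u / (u.factorial : ℝ) := Nat.choose_le_pow_div u n
  have h2 : (((u.choose 2).choose k : ℕ) : ℝ) ≤ ((u.choose 2 : ℕ) : ℝ) ^ k / (k.factorial : ℝ) :=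
    Nat.choose_le_pow_div k _
  have h3 : ((u.choose 2 : ℕ) : ℝ) ≤ (u : ℝ) ^ 2 / 2 := by
    rw [Nat.cast_choose_two]
    nlinarith [(Nat.cast_nonneg u : (0 : ℝ) ≤ u)]
  have hu1 : (1 : ℝ) ≤ u := by exact_mod_cast hu
  have h4 : ((u.choose 2 : ℕ) : ℝ) ^ k / (k.factorial : ℝ) ≤
      2 * ((u : ℝ) ^ 2 / 2) ^ u / (u.factorial : ℝ) := by
    have h5 : (u.factorial : ℝ) = (u : ℝ) * (k.factorial : ℝ) := by
      rw [hu', Nat.factorial_succ]; push_cast; ring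
    rw [h5, div_le_div_iff₀ (by positivity) (by positivity)]
    have h6 : ((u.choose 2 : ℕ) : ℝ) ^ k ≤ ((u : ℝ) ^ 2 / 2) ^ k := by gcongr
    have h7 : ((u : ℝ) ^ 2 / 2) ^ u = ((u : ℝ) ^ 2 / 2) ^ k * ((u : ℝ) ^ 2 / 2) := by
      rw [hu', pow_succ]
    have h8 : (u : ℝ) ≤ (u : ℝ) ^ 2 := by nlinarith
    calc ((u.choose 2 : ℕ) : ℝ) ^ k * ((u : ℝ) * (k.factorial : ℝ))
        ≤ ((u : ℝ) ^ 2 / 2) ^ k * ((u : ℝ) ^ 2 * (k.factorial : ℝ)) := by gcongr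
      _ = _ := by rw [h7]; ring
  calc (n.choose u : ℝ) * ((u.choose 2).choose (u - 1) : ℝ)
      ≤ ((n : ℝ) ^ u / (u.factorial : ℝ)) *
        (2 * ((u : ℝ) ^ 2 / 2) ^ u / (u.factorial : ℝ)) := by
        gcongr
        exact h2.trans h4
    _ = 2 * (n : ℝ) ^ u * (1 / 2) ^ u * ((u : ℝ) ^ u / (u.factorial : ℝ)) ^ 2 := by
        rw [show (u : ℝ) ^ 2 / 2 = (u : ℝ) * u * (1 / 2) by ring, mul_pow, mul_pow]
        field_simp
    _ ≤ 2 * (n : ℝ) ^ u * (1 / 2) ^ u * (Real.exp u) ^ 2 := by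
        have h := Real.pow_div_factorial_le_exp (u : ℝ) (Nat.cast_nonneg u) u
        gcongr
    _ = _ := by
        rw [div_pow (Real.exp 2), ← Real.exp_nat_mul, ← Real.exp_nat_mul, div_pow, one_pow,
          mul_comm (u : ℝ) 2, Nat.cast_ofNat]
        ring

/-- The term of the first moment bound that belongs to sets with `u` vertices. -/
lemma first_moment_term_le {n u : ℕ} (hu : 1 ≤ u) (hn : 1 ≤ n) {c γ : ℝ} (hc : 0 < c)
    (hγ : 0 ≤ γ) :
    (n.choose u : ℝ) * (((u.choose 2).choose (u - 1) : ℝ) * (c / n) ^ (u - 1) * γ ^ u) ≤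
      2 * n / c * (Real.exp 2 / 2 * c * γ) ^ u := by
  have hn' : (0 : ℝ) < n := by exact_mod_cast hn
  have h : (c / n) ^ (u - 1) = (c / n) ^ u * (n / c) := by
    obtain ⟨k, rfl⟩ : ∃ k, u = k + 1 := ⟨u - 1, by omega⟩
    rw [Nat.add_sub_cancel, pow_succ]
    field_simp
  calc (n.choose u : ℝ) * (((u.choose 2).choose (u - 1) : ℝ) * (c / n) ^ (u - 1) * γ ^ u)
      = ((n.choose u : ℝ) * ((u.choose 2).choose (u - 1) : ℝ)) * ((c / n) ^ (u - 1) * γ ^ u) := by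
        ring
    _ ≤ (2 * (n : ℝ) ^ u * (Real.exp 2 / 2) ^ u) * ((c / n) ^ (u - 1) * γ ^ u) :=
        mul_le_mul_of_nonneg_right (choose_mul_choose_le hu) (by positivity)
    _ = _ := by
        rw [h, mul_pow, mul_pow, div_pow c]
        field_simp

/-- The constants of the first moment bound. For `c > 2` the inequality holds in the limit
`d → 0`, `l → ∞`, `q → 1`, because then `c / 2 < exp (c - 2)`. -/
lemma exists_expansion_constants {c : ℝ} (hc : 2 < c) :
    ∃ d l q : ℝ, 0 < d ∧ d < 1 ∧ 0 < l ∧ 0 < q ∧ q < 1 ∧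
      Real.exp 2 / 2 * c *
        (Real.exp (l * (1 - q)) * (Real.exp (-(c * (1 - d))) + Real.exp (-l))) < 1 := by
  have h0 : Real.exp 2 / 2 * c * Real.exp (-c) < 1 := by
    have h1 : c / 2 < Real.exp (c - 2) := by
      have := Real.add_one_le_exp (c - 2)
      linarith
    have h2 : Real.exp 2 / 2 * c * Real.exp (-c) = c / 2 * Real.exp (2 - c) := by
      rw [sub_eq_add_neg, Real.exp_add]; ring
    rw [h2]
    calc c / 2 * Real.exp (2 - c) < Real.exp (c - 2) * Real.exp (2 - c) := by gcongr
      _ = 1 := by rw [← Real.exp_add]; simp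
  obtain ⟨d, hd, hd0, hd1⟩ : ∃ d : ℝ,
      Real.exp 2 / 2 * c * Real.exp (-(c * (1 - d))) < 1 ∧ 0 < d ∧ d < 1 := by
    have hcont : Continuous fun d : ℝ => Real.exp 2 / 2 * c * Real.exp (-(c * (1 - d))) := by
      fun_prop
    have ht := (hcont.tendsto 0).mono_left (nhdsWithin_le_nhds (s := Set.Ioi 0))
    have h1 := ht.eventually (gt_mem_nhds (show
      Real.exp 2 / 2 * c * Real.exp (-(c * (1 - 0))) < 1 by simpa using h0))
    obtain ⟨d, h2, h3⟩ := (h1.and (Ioo_mem_nhdsGT (zero_lt_one' ℝ))).exists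
    exact ⟨d, h2, h3.1, h3.2⟩
  obtain ⟨l, hl, hl0⟩ : ∃ l : ℝ,
      Real.exp 2 / 2 * c * (Real.exp (-(c * (1 - d))) + Real.exp (-l)) < 1 ∧ 0 < l := by
    have ht : Tendsto (fun l : ℝ => Real.exp 2 / 2 * c *
        (Real.exp (-(c * (1 - d))) + Real.exp (-l))) atTop
        (𝓝 (Real.exp 2 / 2 * c * (Real.exp (-(c * (1 - d))) + 0))) :=
      (tendsto_const_nhds.add Real.tendsto_exp_neg_atTop_nhds_zero).const_mul _
    have h1 := ht.eventually (gt_mem_nhds (by rwa [add_zero]))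
    exact (h1.and (eventually_gt_atTop 0)).exists
  have hcont : Continuous fun q : ℝ => Real.exp 2 / 2 * c *
      (Real.exp (l * (1 - q)) * (Real.exp (-(c * (1 - d))) + Real.exp (-l))) := by
    fun_prop
  have ht := (hcont.tendsto 1).mono_left (nhdsWithin_le_nhds (s := Set.Iio 1))
  have h1 := ht.eventually (gt_mem_nhds (show _ < (1 : ℝ) by simpa using hl))
  obtain ⟨q, h2, h3⟩ := (h1.and (Ioo_mem_nhdsLT (zero_lt_one' ℝ))).exists
  exact ⟨d, l, q, hd0, hd1, hl0, h3.1, h3.2, h2⟩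

lemma coe_projIcc_div {c : ℝ} (hc : 0 < c) {n : ℕ} (hn : c ≤ n) :
    ((Set.projIcc (0 : ℝ) 1 zero_le_one (c / n) : unitInterval) : ℝ) = c / n := by
  have hn' : (0 : ℝ) < n := hc.trans_le hn
  rw [Set.projIcc_of_mem zero_le_one ⟨by positivity, (div_le_one hn').mpr hn⟩]

instance (c : ℝ) (n : ℕ) : IsProbabilityMeasure (sparseRandomGraph c n) := by
  unfold sparseRandomGraph; infer_instance

/-- For `c > 2`, all finite distances in `G(n, c/n)` are `O(log n)` with high probability. -/
theorem exists_tendsto_edist_le_log {c : ℝ} (hc : 2 < c) :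
    ∃ K : ℝ, 0 < K ∧ Tendsto (fun n : ℕ => (sparseRandomGraph c n).real
      {G | ¬ ∀ x y, G.edist x y ≠ ⊤ → G.edist x y ≤ (⌊K * Real.log n⌋₊ : ℕ)}) atTop (𝓝 0) := by
  obtain ⟨d, l, q, hd0, hd1, hl0, hq0, hq1, hlt⟩ := exists_expansion_constants hc
  have hc0 : 0 < c := by linarith
  set γ := Real.exp (l * (1 - q)) * (Real.exp (-(c * (1 - d))) + Real.exp (-l)) with hγ
  have hγ0 : 0 < γ := by positivity
  set ρ := Real.exp 2 / 2 * c * γ with hρ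
  have hρ0 : 0 < ρ := by positivity
  have hlρ : 0 < -Real.log ρ := by linarith [Real.log_neg hρ0 hlt]
  have hlq : 0 < -Real.log q := by linarith [Real.log_neg hq0 hq1]
  set a := 3 / -Real.log ρ with ha
  set b := 2 / -Real.log q with hb
  have ha0 : 0 < a := by positivity
  have hb0 : 0 < b := by positivity
  set T := ⌈1 / d⌉₊ with hT
  refine ⟨(T + 1) * (2 * a + 2 * b + 5), by positivity, ?_⟩
  have hlim : Tendsto (fun n : ℕ => 2 / c * ((n : ℝ))⁻¹) atTop (𝓝 0) := by
    simpa using (tendsto_inv_atTop_nhds_zero_nat (𝕜 := ℝ)).const_mul (2 / c)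
  refine tendsto_of_tendsto_of_tendsto_of_le_of_le' tendsto_const_nhds hlim
    (Eventually.of_forall fun n => measureReal_nonneg) ?_
  filter_upwards [eventually_ge_atTop 3, eventually_ge_atTop ⌈c⌉₊] with n hn3 hnc'
  have hnc : c ≤ n := (Nat.le_ceil c).trans (by exact_mod_cast hnc')
  have hn3' : (3 : ℝ) ≤ n := by exact_mod_cast hn3
  have hn0 : (0 : ℝ) < n := by linarith
  have hlog : 1 ≤ Real.log n := by
    rw [Real.le_log_iff_exp_le hn0]
    exact Real.exp_one_lt_three.le.trans hn3'
  set u₀ := ⌈a * Real.log n⌉₊ with hu₀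
  set J := ⌈b * Real.log n⌉₊ with hJ
  set m := ⌊d * n⌋₊ with hm
  have hu1 : 1 ≤ u₀ := Nat.one_le_iff_ne_zero.mpr (Nat.ceil_pos.mpr (by positivity)).ne'
  have hmd : (m : ℝ) ≤ d * n := Nat.floor_le (by positivity)
  -- `q ^ J` is at most `n ^ (-2)`, so that it beats `m`.
  have hqJ : q ^ J * m < 1 := by
    have h1 : q ^ J ≤ ((n : ℝ) ^ 2)⁻¹ := by
      rw [← Real.exp_log hq0, ← Real.exp_nat_mul, ← Real.exp_log (pow_pos hn0 2), ← Real.exp_neg,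
        Real.log_pow]
      apply Real.exp_le_exp.mpr
      have h2 : b * Real.log n ≤ J := Nat.le_ceil _
      have h3 : b * -Real.log q = 2 := div_mul_cancel₀ _ hlq.ne'
      push_cast
      nlinarith
    calc q ^ J * m ≤ ((n : ℝ) ^ 2)⁻¹ * (d * n) := by gcongr
      _ = d / n := by field_simp
      _ < 1 := by rw [div_lt_one hn0]; linarith
  have hTn : Fintype.card (Fin n) < (T + 1) * (m + 1) := by
    rw [Fintype.card_fin]
    have h1 : 1 / d ≤ T := Nat.le_ceil _
    have h2 : d * n < m + 1 := Nat.lt_floor_add_one _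
    have h3 : (n : ℝ) = 1 / d * (d * n) := by field_simp
    have h4 : (n : ℝ) < (T + 1) * (m + 1) := by
      rw [h3]
      apply mul_lt_mul' (by linarith) h2 (by positivity) (by positivity)
    exact_mod_cast h4
  have hrad : (T + 1) * (2 * (u₀ + J) + 1) ≤
      ⌊(T + 1) * (2 * a + 2 * b + 5) * Real.log n⌋₊ := by
    apply Nat.le_floor
    have h1 : (u₀ : ℝ) < a * Real.log n + 1 := Nat.ceil_lt_add_one (by positivity)
    have h2 : (J : ℝ) < b * Real.log n + 1 := Nat.ceil_lt_add_one (by positivity)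
    push_cast
    rw [mul_assoc]
    gcongr
    nlinarith
  have hsub : {G : SimpleGraph (Fin n) | ¬ ∀ x y, G.edist x y ≠ ⊤ →
      G.edist x y ≤ (⌊(T + 1) * (2 * a + 2 * b + 5) * Real.log n⌋₊ : ℕ)} ⊆
      {G | ¬ Expands G u₀ m q} := by
    intro G hG hexp
    apply hG
    intro x y hxy
    exact (hexp.edist_le hq0 hqJ hTn hxy).trans (by exact_mod_cast hrad)
  refine (measureReal_mono hsub (measure_ne_top _ _)).trans ?_
  refine (binomialRandom_real_not_expands_le_sum _ u₀ m q l hl0.le).trans ?_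
  rw [coe_projIcc_div hc0 hnc, Fintype.card_fin]
  have hp0 : 0 ≤ c / n := by positivity
  have hp1 : 0 ≤ 1 - c / n := by rw [sub_nonneg, div_le_one hn0]; exact hnc
  have hmn : m ≤ n := by
    have : (m : ℝ) ≤ n := by nlinarith
    exact_mod_cast this
  calc _ ≤ ∑ u ∈ Finset.Icc u₀ m, 2 * n / c * ρ ^ u₀ := by
        refine Finset.sum_le_sum fun u hu => ?_
        rw [Finset.mem_Icc] at hu
        have hun : u ≤ n := hu.2.trans hmn
        have h1 : (1 - c / n) ^ (n - u) ≤ Real.exp (-(c * (1 - d))) := by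
          calc (1 - c / n) ^ (n - u) ≤ (Real.exp (-(c / n))) ^ (n - u) := by
                gcongr
                have := Real.add_one_le_exp (-(c / n))
                linarith
            _ = Real.exp (-(c * ((n - u) / n))) := by
                rw [← Real.exp_nat_mul, Nat.cast_sub hun]
                congr 1
                field_simp
            _ ≤ _ := by
                apply Real.exp_le_exp.mpr
                have h2 : (u : ℝ) ≤ d * n := le_trans (by exact_mod_cast hu.2) hmd
                have h3 : 1 - d ≤ (n - u) / n := by
                  rw [le_div_iff₀ hn0]; linarith
                nlinarith
        calc _ ≤ (n.choose u : ℝ) * (((u.choose 2).choose (u - 1) : ℝ) * (c / n) ^ (u - 1) *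
              γ ^ u) := by
              rw [hγ]
              gcongr
          _ ≤ 2 * n / c * ρ ^ u :=
              first_moment_term_le (hu1.trans hu.1) (by omega) hc0 hγ0.le
          _ ≤ _ := by
              gcongr ?_ * ?_
              exact pow_le_pow_of_le_one hρ0.le hlt.le hu.1
    _ = ((m + 1 - u₀ : ℕ) : ℝ) * (2 * n / c * ρ ^ u₀) := by
        rw [Finset.sum_const, Nat.card_Icc, nsmul_eq_mul]
    _ ≤ n * (2 * n / c * ((n : ℝ) ^ 3)⁻¹) := by
        have h1 : ρ ^ u₀ ≤ ((n : ℝ) ^ 3)⁻¹ := by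
          rw [← Real.exp_log hρ0, ← Real.exp_nat_mul, ← Real.exp_log (pow_pos hn0 3),
            ← Real.exp_neg, Real.log_pow]
          apply Real.exp_le_exp.mpr
          have h2 : a * Real.log n ≤ u₀ := Nat.le_ceil _
          have h3 : a * -Real.log ρ = 3 := div_mul_cancel₀ _ hlρ.ne'
          push_cast
          nlinarith
        have h2 : ((m + 1 - u₀ : ℕ) : ℝ) ≤ n := by exact_mod_cast (by omega)
        gcongr
    _ = 2 / c * (n : ℝ)⁻¹ := by field_simp

/-- Exponential Markov inequality for the number of edges of `G(n, c/n)`. -/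
lemma sparseRandomGraph_real_edges_le {c : ℝ} (hc : 0 < c) {n : ℕ} (hn : c ≤ n)
    (A : Set (SimpleGraph (Fin n))) (l y : ℝ) (hA : ∀ G ∈ A, y ≤ l * G.edgeSet.ncard) :
    (sparseRandomGraph c n).real A ≤
      Real.exp (c * (n - 1) / 2 * (Real.exp l - 1) - y) := by
  have hn0 : (0 : ℝ) < n := hc.trans_le hn
  have hp1 : c / n ≤ 1 := (div_le_one hn0).mpr hn
  have hp0 : 0 < c / n := by positivity
  have h := binomialRandom_real_edges_markov (Set.projIcc (0 : ℝ) 1 zero_le_one (c / n)) A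
    (Real.exp l) (Real.exp y) (by positivity) (by positivity) (fun G hG => by
      rw [← Real.exp_nat_mul, mul_comm]
      exact Real.exp_le_exp.mpr (hA G hG))
  rw [coe_projIcc_div hc hn, Fintype.card_fin] at h
  have h2 : (1 + c / n * (Real.exp l - 1)) ^ (n.choose 2) ≤
      Real.exp (c * (n - 1) / 2 * (Real.exp l - 1)) := by
    calc (1 + c / n * (Real.exp l - 1)) ^ (n.choose 2)
        ≤ (Real.exp (c / n * (Real.exp l - 1))) ^ (n.choose 2) := by
          gcongr
          · nlinarith [Real.exp_pos l]
          · linarith [Real.add_one_le_exp (c / n * (Real.exp l - 1))]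
      _ = _ := by
          rw [← Real.exp_nat_mul, Nat.cast_choose_two]
          congr 1
          field_simp
  rw [Real.exp_sub, le_div_iff₀ (Real.exp_pos y), mul_comm]
  exact h.trans h2

theorem tendsto_real_edges_lt {c ε : ℝ} (hc : 0 < c) (hε : 0 < ε) :
    Tendsto (fun n : ℕ => (sparseRandomGraph c n).real
      {G | (G.edgeSet.ncard : ℝ) < (c / 2 - ε) * n}) atTop (𝓝 0) := by
  -- The optimal exponent for a deviation of `ε n` is of order `ε / c`.
  set l := ε / c with hl
  have hl0 : 0 < l := by positivity
  have hlim : Tendsto (fun n : ℕ => Real.exp (c * l / 2 - (l * ε / 2) * n)) atTop (𝓝 0) := by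
    refine Real.tendsto_exp_atBot.comp (tendsto_atBot_add_const_left _ _ ?_)
    exact tendsto_neg_atTop_atBot.comp
      (tendsto_natCast_atTop_atTop.const_mul_atTop (by positivity))
  refine tendsto_of_tendsto_of_tendsto_of_le_of_le' tendsto_const_nhds hlim
    (Eventually.of_forall fun n => measureReal_nonneg) ?_
  filter_upwards [eventually_ge_atTop 1, eventually_ge_atTop ⌈c⌉₊] with n hn1 hnc'
  have hnc : c ≤ n := (Nat.le_ceil c).trans (by exact_mod_cast hnc')
  have hn1' : (1 : ℝ) ≤ n := by exact_mod_cast hn1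
  refine (sparseRandomGraph_real_edges_le hc hnc _ (-l) (-l * ((c / 2 - ε) * n)) ?_).trans ?_
  · intro G hG
    have hG' : (G.edgeSet.ncard : ℝ) < (c / 2 - ε) * n := hG
    nlinarith
  · apply Real.exp_le_exp.mpr
    have h1 : Real.exp (-l) - 1 ≤ -(l / (1 + l)) := by
      have h2 : Real.exp (-l) ≤ 1 / (1 + l) := by
        rw [Real.exp_neg, ← one_div]
        apply one_div_le_one_div_of_le (by positivity)
        linarith [Real.add_one_le_exp l]
      have h3 : 1 / (1 + l) = 1 - l / (1 + l) := by field_simp; ring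
      linarith
    have h4 : l - l ^ 2 ≤ l / (1 + l) := by
      rw [le_div_iff₀ (by positivity)]
      nlinarith [pow_pos hl0 3]
    have h4' : l / (1 + l) ≤ l := div_le_self hl0.le (by linarith)
    have h5 : c * (n - 1) / 2 * (Real.exp (-l) - 1) ≤ c * (n - 1) / 2 * -(l / (1 + l)) :=
      mul_le_mul_of_nonneg_left h1 (by
        have : (0 : ℝ) ≤ n - 1 := by linarith
        positivity)
    have h6 : c * l = ε := by rw [hl]; field_simp
    have h7 : c * n / 2 * (l - l ^ 2) ≤ c * n / 2 * (l / (1 + l)) :=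
      mul_le_mul_of_nonneg_left h4 (by positivity)
    have h8 : c / 2 * (l / (1 + l)) ≤ c / 2 * l := mul_le_mul_of_nonneg_left h4' (by positivity)
    have h9 : c * n / 2 * (l - l ^ 2) = c * n / 2 * l - ε * n * l / 2 := by rw [← h6]; ring
    nlinarith

theorem tendsto_real_lt_edges {c : ℝ} (hc : 0 < c) :
    Tendsto (fun n : ℕ => (sparseRandomGraph c n).real
      {G | (c + 1) * n < (G.edgeSet.ncard : ℝ)}) atTop (𝓝 0) := by
  have hlim : Tendsto (fun n : ℕ => Real.exp (-(n : ℝ))) atTop (𝓝 0) :=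
    Real.tendsto_exp_atBot.comp (tendsto_neg_atTop_atBot.comp tendsto_natCast_atTop_atTop)
  refine tendsto_of_tendsto_of_tendsto_of_le_of_le' tendsto_const_nhds hlim
    (Eventually.of_forall fun n => measureReal_nonneg) ?_
  filter_upwards [eventually_ge_atTop 1, eventually_ge_atTop ⌈c⌉₊] with n hn1 hnc'
  have hnc : c ≤ n := (Nat.le_ceil c).trans (by exact_mod_cast hnc')
  have hn1' : (1 : ℝ) ≤ n := by exact_mod_cast hn1
  refine (sparseRandomGraph_real_edges_le hc hnc _ 1 ((c + 1) * n) ?_).trans ?_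
  · intro G hG
    rw [one_mul]
    exact (show (c + 1) * n < (G.edgeSet.ncard : ℝ) from hG).le
  · apply Real.exp_le_exp.mpr
    have h1 : Real.exp 1 - 1 ≤ 2 := by linarith [Real.exp_one_lt_three]
    have h2 : c * (n - 1) / 2 * (Real.exp 1 - 1) ≤ c * (n - 1) / 2 * 2 :=
      mul_le_mul_of_nonneg_left h1 (by
        have : (0 : ℝ) ≤ n - 1 := by linarith
        positivity)
    nlinarith

/-! ### Graphs near a reconstruction -/

open scoped symmDiff

/-- The vertices of `H` that are not isolated. -/
noncomputable def nonIsolated {W : Type*} [Fintype W] (H : SimpleGraph W) : Finset W :=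
  open scoped Classical in Finset.univ.filter fun x => ∃ y, H.Adj x y

open scoped Classical in
lemma sum_adjMatrix {W : Type*} [Fintype W] (H : SimpleGraph W) :
    ∑ x, ∑ y, H.adjMatrix ℝ x y = 2 * (H.edgeSet.ncard : ℝ) := by
  have h := H.sum_degrees_eq_twice_card_edges
  have h2 : H.edgeSet.ncard = H.edgeFinset.card := by
    rw [Set.ncard_eq_toFinset_card', SimpleGraph.edgeFinset]
  rw [h2]
  have h3 : ((∑ v, H.degree v : ℕ) : ℝ) = ((2 * H.edgeFinset.card : ℕ) : ℝ) := by rw [h]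
  push_cast at h3
  rw [← h3]
  refine Finset.sum_congr rfl fun x _ => ?_
  rw [SimpleGraph.degree_eq_sum_if_adj]
  simp [SimpleGraph.adjMatrix_apply]

open scoped Classical in
lemma card_nonIsolated_le {W : Type*} [Fintype W] (H : SimpleGraph W) :
    ((nonIsolated H).card : ℝ) ≤ ∑ x, ∑ y, H.adjMatrix ℝ x y := by
  have hnn : ∀ x y, 0 ≤ H.adjMatrix ℝ x y := fun x y => by
    rw [SimpleGraph.adjMatrix_apply]; split_ifs <;> norm_num
  calc ((nonIsolated H).card : ℝ) = ∑ x ∈ nonIsolated H, (1 : ℝ) := by simp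
    _ ≤ ∑ x ∈ nonIsolated H, ∑ y, H.adjMatrix ℝ x y := by
        refine Finset.sum_le_sum fun x hx => ?_
        rw [nonIsolated, Finset.mem_filter] at hx
        obtain ⟨y, hy⟩ := hx.2
        calc (1 : ℝ) = H.adjMatrix ℝ x y := by rw [SimpleGraph.adjMatrix_apply, if_pos hy]
          _ ≤ _ := Finset.single_le_sum (fun y _ => hnn x y) (Finset.mem_univ y)
    _ ≤ _ := Finset.sum_le_sum_of_subset_of_nonneg (Finset.subset_univ _)
        fun x _ _ => Finset.sum_nonneg fun y _ => hnn x y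

section

variable {W W' : Type*} [Fintype W] [Fintype W']

open scoped Classical in
/-- The `ℓ¹` distance of two adjacency matrices counts each differing edge twice, so it bounds
the number of edges in which `G` differs from the pullback of `H`. -/
lemma two_mul_card_edges_symmDiff_le {X : Type*} [Fintype X] (H : SimpleGraph W)
    (G : SimpleGraph X) (ι : X ↪ W')
    {K : SimpleGraph W'} (hK : K = G.map ι) (σ : W ≃ W') :
    2 * ((G ∆ H.comap (σ.symm ∘ ι)).edgeSet.ncard : ℝ) ≤
      ∑ x, ∑ y, |H.adjMatrix ℝ x y - K.adjMatrix ℝ (σ x) (σ y)| := by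
  set f : W' → W' → ℝ := fun x y =>
    |H.adjMatrix ℝ (σ.symm x) (σ.symm y) - K.adjMatrix ℝ x y| with hf
  have h1 : ∑ x, ∑ y, |H.adjMatrix ℝ x y - K.adjMatrix ℝ (σ x) (σ y)| =
      ∑ x, ∑ y, f x y := by
    rw [← σ.sum_comp]
    refine Finset.sum_congr rfl fun x _ => ?_
    rw [← σ.sum_comp]
    simp [hf]
  rw [h1, ← sum_adjMatrix]
  have hnn : ∀ x y, 0 ≤ f x y := fun x y => abs_nonneg _
  calc ∑ x, ∑ y, (G ∆ H.comap (σ.symm ∘ ι)).adjMatrix ℝ x y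
      = ∑ x : X, ∑ y : X, f (ι x) (ι y) := by
        refine Finset.sum_congr rfl fun x _ => Finset.sum_congr rfl fun y _ => ?_
        have hadj : (G ∆ H.comap (σ.symm ∘ ι)).Adj x y ↔
            ¬ (G.Adj x y ↔ H.Adj (σ.symm (ι x)) (σ.symm (ι y))) := by
          rw [symmDiff_def, SimpleGraph.sup_adj, SimpleGraph.sdiff_adj, SimpleGraph.sdiff_adj,
            SimpleGraph.comap_adj]
          simp only [Function.comp_apply]
          tauto
        have hadj' : K.Adj (ι x) (ι y) ↔ G.Adj x y := by rw [hK, SimpleGraph.map_adj_apply]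
        simp only [hf, SimpleGraph.adjMatrix_apply, hadj, hadj']
        by_cases h2 : G.Adj x y <;> by_cases h3 : H.Adj (σ.symm (ι x)) (σ.symm (ι y)) <;>
          simp [h2, h3]
    _ = ∑ x ∈ Finset.univ.map ι, ∑ y ∈ Finset.univ.map ι, f x y := by
        simp only [Finset.sum_map]
    _ ≤ ∑ x ∈ Finset.univ.map ι, ∑ y, f x y :=
        Finset.sum_le_sum fun x _ => Finset.sum_le_sum_of_subset_of_nonneg
          (Finset.subset_univ _) fun y _ _ => hnn x y
    _ ≤ _ := Finset.sum_le_sum_of_subset_of_nonneg (Finset.subset_univ _)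
          fun x _ _ => Finset.sum_nonneg fun y _ => hnn x y

open scoped Classical in
/-- The number of nonisolated vertices of `H` is at most twice its number of edges, which exceeds
twice that of `G` by at most the `ℓ¹` distance. -/
lemma card_nonIsolated_le_add {X : Type*} [Fintype X] (H : SimpleGraph W)
    (G : SimpleGraph X) (ι : X ↪ W')
    {K : SimpleGraph W'} (hK : K = G.map ι) (σ : W ≃ W') :
    ((nonIsolated H).card : ℝ) ≤
      ∑ x, ∑ y, |H.adjMatrix ℝ x y - K.adjMatrix ℝ (σ x) (σ y)| +
        2 * (G.edgeSet.ncard : ℝ) := by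
  have h1 : ∑ x, ∑ y, K.adjMatrix ℝ (σ x) (σ y) = 2 * (G.edgeSet.ncard : ℝ) := by
    calc ∑ x, ∑ y, K.adjMatrix ℝ (σ x) (σ y)
        = ∑ x, ∑ y, K.adjMatrix ℝ x y := by
          rw [← σ.sum_comp]
          exact Finset.sum_congr rfl fun x _ => σ.sum_comp _
      _ = _ := by
          rw [sum_adjMatrix, hK, SimpleGraph.edgeSet_map,
            Set.ncard_image_of_injective _ ι.sym2Map.injective]
  rw [← h1, ← Finset.sum_add_distrib]
  refine (card_nonIsolated_le H).trans (Finset.sum_le_sum fun x _ => ?_)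
  rw [← Finset.sum_add_distrib]
  refine Finset.sum_le_sum fun y _ => ?_
  linarith [le_abs_self (H.adjMatrix ℝ x y - K.adjMatrix ℝ (σ x) (σ y))]

/-- Pulling `H` back along a map only uses the nonisolated vertices of `H`: all the isolated ones
may be merged into a single one. -/
lemma exists_comap_eq {X : Type*} (H : SimpleGraph W) (g : X → W) :
    ∃ g' : X → Option (nonIsolated H), H.comap g =
      ((H.comap (Subtype.val : nonIsolated H → W)).map Function.Embedding.some).comap g' := by
  classical
  refine ⟨fun x => if h : g x ∈ nonIsolated H then some ⟨g x, h⟩ else none, ?_⟩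
  ext x y
  simp only [SimpleGraph.comap_adj, SimpleGraph.map_adj]
  constructor
  · intro h
    have hx : g x ∈ nonIsolated H := by
      rw [nonIsolated, Finset.mem_filter]; exact ⟨Finset.mem_univ _, _, h⟩
    have hy : g y ∈ nonIsolated H := by
      rw [nonIsolated, Finset.mem_filter]; exact ⟨Finset.mem_univ _, _, h.symm⟩
    exact ⟨⟨g x, hx⟩, ⟨g y, hy⟩, h, by simp [hx], by simp [hy]⟩
  · rintro ⟨a, b, hab, ha, hb⟩
    split_ifs at ha with h1
    · split_ifs at hb with h2
      · simp only [Function.Embedding.some_apply, Option.some.injEq] at ha hb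
        subst ha hb
        exact hab
      · simp at hb
    · simp at ha

/-- A finite set with at most `k` elements, listed with repetitions of a dummy element. -/
lemma exists_enumeration {α : Type*} (D : Finset α) (k : ℕ) (hD : D.card ≤ k) :
    ∃ t : Fin k → Option α, ∀ e, e ∈ D ↔ ∃ i, t i = some e := by
  refine ⟨fun i => if h : i.1 < D.card then some (D.equivFin.symm ⟨i.1, h⟩).1 else none, ?_⟩
  intro e
  constructor
  · intro he
    refine ⟨⟨(D.equivFin ⟨e, he⟩).1, (D.equivFin ⟨e, he⟩).2.trans_le hD⟩, ?_⟩
    simp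
  · rintro ⟨i, hi⟩
    dsimp only at hi
    split_ifs at hi with h
    · rw [Option.some.injEq] at hi
      exact hi ▸ (D.equivFin.symm ⟨i.1, h⟩).2

/-- The number of graphs that differ in at most `k` edges from some pullback of a given graph. -/
lemma card_graphs_near_pullback_le {X : Type*} [Fintype X] {n : ℕ} (hn : Fintype.card X = n)
    (H : SimpleGraph W) (k : ℕ) :
    {G : SimpleGraph X | ∃ g : X → W, (G ∆ H.comap g).edgeSet.ncard ≤ k}.ncard ≤
      ((nonIsolated H).card + 1) ^ n * (n ^ 2 + 1) ^ k := by
  classical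
  subst hn
  set H' := (H.comap (Subtype.val : nonIsolated H → W)).map Function.Embedding.some with hH'
  let Φ : (X → Option (nonIsolated H)) × (Fin k → Option (Sym2 X)) → SimpleGraph X := fun a =>
    SimpleGraph.fromEdgeSet {e | ∃ i, a.2 i = some e} ∆ H'.comap a.1
  have hsub : {G : SimpleGraph X | ∃ g : X → W, (G ∆ H.comap g).edgeSet.ncard ≤ k} ⊆
      Set.range Φ := by
    rintro G ⟨g, hg⟩
    obtain ⟨g', hg'⟩ := exists_comap_eq H g
    obtain ⟨t, ht⟩ := exists_enumeration (G ∆ H.comap g).edgeFinset k (by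
      rwa [Set.ncard_eq_toFinset_card'] at hg)
    refine ⟨(g', t), ?_⟩
    have h1 : {e | ∃ i, t i = some e} = (G ∆ H.comap g).edgeSet := by
      ext e
      rw [Set.mem_ofPred_eq, ← ht, SimpleGraph.mem_edgeFinset]
    simp only [Φ]
    rw [h1, SimpleGraph.fromEdgeSet_edgeSet, ← hg', symmDiff_symmDiff_cancel_right]
  calc _ ≤ (Set.range Φ).ncard := Set.ncard_le_ncard hsub (Set.toFinite _)
    _ ≤ Fintype.card ((X → Option (nonIsolated H)) × (Fin k → Option (Sym2 X))) := by
        rw [← Set.image_univ]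
        refine (Set.ncard_image_le (Set.toFinite _)).trans ?_
        rw [Set.ncard_univ, Nat.card_eq_fintype_card]
    _ = ((nonIsolated H).card + 1) ^ Fintype.card X *
          ((Fintype.card X + 1).choose 2 + 1) ^ k := by
        simp [Fintype.card_prod, Sym2.card]
    _ ≤ _ := by
        gcongr
        rw [Nat.choose_two_right, Nat.add_sub_cancel]
        apply Nat.div_le_of_le_mul
        nlinarith [Nat.le_self_pow (n := 2) (by norm_num) (Fintype.card X)]

end

lemma padIsolated_splitNodes {n : ℕ} (V : Finset (Fin n)) (G : SimpleGraph (Fin n)) (k : ℕ) :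
    padIsolated (splitNodes V G) k =
      G.map ((Equiv.sumCompl (fun x => x ∈ V)).symm.toEmbedding.trans
        (Function.Embedding.sumMap (Function.Embedding.refl _) Function.Embedding.inl)) := by
  unfold padIsolated splitNodes
  rw [Function.Embedding.coe_trans, ← SimpleGraph.map_map]
  congr 1
  ext x y
  simp only [SimpleGraph.comap_adj, SimpleGraph.map_adj]
  constructor
  · intro h
    exact ⟨_, _, h, by simp, by simp⟩
  · rintro ⟨a, b, h, rfl, rfl⟩
    simpa using h

/-- The number of graphs with at most `m` edges within edit distance `r` of a reconstruction. -/
theorem card_graphs_near_reconstruction_le {n : ℕ} (V : Finset (Fin n)) (R : Reconstruction V)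
    {r : ℝ} (hr : 0 ≤ r) (m : ℕ) :
    {G : SimpleGraph (Fin n) | editDist R.2 (splitNodes V G) ≤ r ∧ G.edgeSet.ncard ≤ m}.ncard ≤
      (⌊r⌋₊ + 2 * m + 1) ^ n * (n ^ 2 + 1) ^ ⌊r / 2⌋₊ := by
  classical
  set S := {G : SimpleGraph (Fin n) | editDist R.2 (splitNodes V G) ≤ r ∧ G.edgeSet.ncard ≤ m}
    with hS
  rcases S.eq_empty_or_nonempty with h0 | hne
  · rw [h0, Set.ncard_empty]; exact Nat.zero_le _
  set H := padIsolated R.2 (Fintype.card {x // x ∉ V} - Fintype.card (Fin R.1)) with hH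
  have key : ∀ G ∈ S, ((nonIsolated H).card : ℝ) ≤ r + 2 * m ∧
      ∃ g, (G ∆ H.comap g).edgeSet.ncard ≤ ⌊r / 2⌋₊ := by
    rintro G ⟨hG, hm⟩
    obtain ⟨π, hπ⟩ := exists_eq_ciInf_of_finite (f := fun π => matrixDiff R.2 (splitNodes V G) π)
    have hle : matrixDiff R.2 (splitNodes V G) π ≤ r := by
      rw [hπ]; exact hG
    unfold matrixDiff at hle
    have hm' : (G.edgeSet.ncard : ℝ) ≤ m := by exact_mod_cast hm
    refine ⟨?_, (Equiv.sumCongr (Equiv.refl _) π).symm ∘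
        ((Equiv.sumCompl (fun x => x ∈ V)).symm.toEmbedding.trans
        (Function.Embedding.sumMap (Function.Embedding.refl _) Function.Embedding.inl)), ?_⟩
    · have h1 := card_nonIsolated_le_add H G _ (padIsolated_splitNodes V G _)
        (Equiv.sumCongr (Equiv.refl _) π)
      refine h1.trans (add_le_add hle (by linarith))
    · apply Nat.le_floor
      have h1 := two_mul_card_edges_symmDiff_le H G _ (padIsolated_splitNodes V G _)
        (Equiv.sumCongr (Equiv.refl _) π)
      have h2 := h1.trans hle
      linarith
  have hcard : (nonIsolated H).card ≤ ⌊r⌋₊ + 2 * m := by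
    obtain ⟨G, hG⟩ := hne
    have h1 := Nat.le_floor ((key G hG).1.trans_eq (by push_cast; rfl : r + 2 * m = r + (2 * m : ℕ)))
    rwa [Nat.floor_add_natCast hr] at h1
  have h2 := card_graphs_near_pullback_le (Fintype.card_fin n) H ⌊r / 2⌋₊
  calc S.ncard ≤ _ := Set.ncard_le_ncard (fun G hG => (key G hG).2) (Set.toFinite _)
    _ ≤ _ := h2
    _ ≤ _ := by gcongr

/-! ### The union bound over distance matrices -/

lemma reconstructionError_nonneg {n : ℕ} (V : Finset (Fin n)) (Ghat : Estimator V)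
    (G : SimpleGraph (Fin n)) : 0 ≤ reconstructionError V Ghat G :=
  Real.iInf_nonneg fun _ => Finset.sum_nonneg fun _ _ => Finset.sum_nonneg fun _ _ => abs_nonneg _

/-- The event of a small reconstruction error, for graphs with bounded distances and with a number
of edges between `y` and `m`: there are few distance matrices, each one yields a single estimate,
few graphs are close to it, and each of these has a small probability. -/
lemma real_reconstructed_le {c : ℝ} (hc : 0 < c) {n : ℕ} (hn : c ≤ n) (V : Finset (Fin n))
    (Ghat : Estimator V) {r : ℝ} (hr : 0 ≤ r) (D m : ℕ) (y : ℝ) :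
    (sparseRandomGraph c n).real {G | (∀ i j, G.edist i j ≠ ⊤ → G.edist i j ≤ (D : ℕ∞)) ∧
      y ≤ G.edgeSet.ncard ∧ G.edgeSet.ncard ≤ m ∧ reconstructionError V Ghat G ≤ r} ≤
    (D + 2 : ℝ) ^ (V.card ^ 2) * (((⌊r⌋₊ + 2 * m + 1 : ℕ) : ℝ) ^ n *
      ((n : ℝ) ^ 2 + 1) ^ ⌊r / 2⌋₊) * Real.exp (-(y * (Real.log n - Real.log c))) := by
  classical
  have hn0 : (0 : ℝ) < n := hc.trans_le hn
  let dec : ({x // x ∈ V} → {x // x ∈ V} → Option (Fin (D + 1))) →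
      {x // x ∈ V} → {x // x ∈ V} → ℕ∞ := fun f i j => (f i j).elim ⊤ fun k => (k.1 : ℕ∞)
  let A : ({x // x ∈ V} → {x // x ∈ V} → Option (Fin (D + 1))) → Set (SimpleGraph (Fin n)) :=
    fun f => {G | y ≤ G.edgeSet.ncard ∧
      editDist (Ghat (dec f)).2 (splitNodes V G) ≤ r ∧ G.edgeSet.ncard ≤ m}
  have hA : ∀ f, (sparseRandomGraph c n).real (A f) ≤
      (((⌊r⌋₊ + 2 * m + 1 : ℕ) : ℝ) ^ n * ((n : ℝ) ^ 2 + 1) ^ ⌊r / 2⌋₊) *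
        Real.exp (-(y * (Real.log n - Real.log c))) := by
    intro f
    have h1 := binomialRandom_real_le_sum (Set.projIcc (0 : ℝ) 1 zero_le_one (c / n))
      (Finset.univ.filter (· ∈ A f))
    rw [show ((Finset.univ.filter (· ∈ A f) : Finset (SimpleGraph (Fin n))) :
      Set (SimpleGraph (Fin n))) = A f by ext; simp] at h1
    refine h1.trans ?_
    have hcard : ((Finset.univ.filter (· ∈ A f)).card : ℝ) ≤
        ((⌊r⌋₊ + 2 * m + 1 : ℕ) : ℝ) ^ n * ((n : ℝ) ^ 2 + 1) ^ ⌊r / 2⌋₊ := by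
      have h2 := card_graphs_near_reconstruction_le V (Ghat (dec f)) hr m
      have h3 : (Finset.univ.filter (· ∈ A f)).card ≤ {G : SimpleGraph (Fin n) |
          editDist (Ghat (dec f)).2 (splitNodes V G) ≤ r ∧ G.edgeSet.ncard ≤ m}.ncard := by
        rw [← Set.ncard_coe_finset]
        refine Set.ncard_le_ncard (fun G hG => ?_) (Set.toFinite _)
        rw [Finset.mem_coe, Finset.mem_filter] at hG
        exact hG.2.2
      exact_mod_cast h3.trans h2
    calc ∑ G ∈ Finset.univ.filter (· ∈ A f), _
        ≤ ∑ G ∈ Finset.univ.filter (· ∈ A f),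
          Real.exp (-(y * (Real.log n - Real.log c))) := by
          refine Finset.sum_le_sum fun G hG => ?_
          have hG' : y ≤ G.edgeSet.ncard := (Finset.mem_filter.mp hG).2.1
          refine (binomialRandom_real_singleton_le _ G).trans ?_
          rw [coe_projIcc_div hc hn, ← Real.exp_log (show 0 < c / n by positivity),
            ← Real.exp_nat_mul, Real.log_div hc.ne' hn0.ne']
          apply Real.exp_le_exp.mpr
          have h4 : Real.log c ≤ Real.log n := Real.log_le_log hc hn
          nlinarith
      _ = ((Finset.univ.filter (· ∈ A f)).card : ℝ) *
          Real.exp (-(y * (Real.log n - Real.log c))) := by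
          rw [Finset.sum_const, nsmul_eq_mul]
      _ ≤ _ := by gcongr
  have hsub : {G | (∀ i j, G.edist i j ≠ ⊤ → G.edist i j ≤ (D : ℕ∞)) ∧
      y ≤ G.edgeSet.ncard ∧ G.edgeSet.ncard ≤ m ∧ reconstructionError V Ghat G ≤ r} ⊆
      ⋃ f ∈ (Finset.univ : Finset ({x // x ∈ V} → {x // x ∈ V} → Option (Fin (D + 1)))), A f := by
    rintro G ⟨hD, hy, hm, herr⟩
    have hdec : ∃ f, dec f = distances V G := by
      have h5 : ∀ i j : {x // x ∈ V}, ∃ o : Option (Fin (D + 1)),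
          o.elim ⊤ (fun k => (k.1 : ℕ∞)) = distances V G i j := by
        intro i j
        by_cases htop : G.edist i.1 j.1 = ⊤
        · exact ⟨none, htop.symm⟩
        · obtain ⟨k, hk⟩ := ENat.ne_top_iff_exists.mp htop
          have hkD := hD _ _ htop
          rw [← hk] at hkD
          have hkD' : k ≤ D := by exact_mod_cast hkD
          exact ⟨some ⟨k, by omega⟩, hk⟩
      choose f hf using h5
      exact ⟨f, funext fun i => funext fun j => hf i j⟩
    obtain ⟨f, hf⟩ := hdec
    simp only [Set.mem_iUnion]
    refine ⟨f, Finset.mem_univ _, hy, ?_, hm⟩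
    rw [hf]
    exact herr
  calc _ ≤ _ := measureReal_mono hsub (measure_ne_top _ _)
    _ ≤ _ := measureReal_biUnion_finset_le _ _
    _ ≤ ∑ f ∈ (Finset.univ : Finset ({x // x ∈ V} → {x // x ∈ V} → Option (Fin (D + 1)))),
        (((⌊r⌋₊ + 2 * m + 1 : ℕ) : ℝ) ^ n * ((n : ℝ) ^ 2 + 1) ^ ⌊r / 2⌋₊) *
        Real.exp (-(y * (Real.log n - Real.log c))) := Finset.sum_le_sum fun f _ => hA f
    _ = _ := by
        rw [Finset.sum_const, nsmul_eq_mul, Finset.card_univ]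
        have h6 : Fintype.card ({x // x ∈ V} → {x // x ∈ V} → Option (Fin (D + 1))) =
            (D + 2) ^ (V.card ^ 2) := by
          simp only [Fintype.card_fun, Fintype.card_option, Fintype.card_fin, Fintype.card_coe]
          rw [← pow_mul, sq]
        rw [h6]
        push_cast
        ring

/-- The three counts multiply to `exp ((c / 2 - 3 η / 4 + o(1)) n log n)`, which the probability
`exp (-(c / 2 - η / 4 + o(1)) n log n)` of a single graph outweighs. -/
lemma eventually_count_mul_exp_le {c δ K η : ℝ} (hc : 0 < c) (hδ : 0 ≤ δ) (hK : 0 < K)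
    (hη : η = 0.5 * c - δ - 1) (hη0 : 0 < η) (v : ℕ → ℕ)
    (hv : ∀ᶠ n : ℕ in atTop, (v n : ℝ) ^ 2 <
      1 / 8 * n * η * (Real.log n / Real.log (Real.log n))) :
    ∀ᶠ n : ℕ in atTop,
      ((⌊K * Real.log n⌋₊ : ℕ) + 2 : ℝ) ^ (v n ^ 2) *
        (((⌊δ * n⌋₊ + 2 * ⌊(c + 1) * n⌋₊ + 1 : ℕ) : ℝ) ^ n *
          ((n : ℝ) ^ 2 + 1) ^ ⌊δ * n / 2⌋₊) *
        Real.exp (-((c / 2 - η / 4) * n * (Real.log n - Real.log c))) ≤ Real.exp (-(n : ℝ)) := by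
  have hlogt : Tendsto (fun n : ℕ => Real.log n) atTop atTop :=
    Real.tendsto_log_atTop.comp tendsto_natCast_atTop_atTop
  set C := δ + 2 * (c + 1) + 1 with hC
  have hC0 : 0 < C := by positivity
  set B := Real.log C + δ / 2 * Real.log 2 + (c / 2 - η / 4) * Real.log c with hB
  filter_upwards [hv, eventually_ge_atTop 1, hlogt.eventually_ge_atTop (K + 2),
    hlogt.eventually_ge_atTop (2 / η * (B + 1))] with n hvn hn1 hL hLB
  have hn1' : (1 : ℝ) ≤ n := by exact_mod_cast hn1
  have hn0 : (0 : ℝ) < n := by linarith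
  set L := Real.log n with hLdef
  have hL1 : 1 < L := by linarith
  have hlL : 0 < Real.log L := Real.log_pos hL1
  have h1 : ((⌊K * L⌋₊ : ℕ) + 2 : ℝ) ^ (v n ^ 2) ≤ Real.exp (n * (η / 4 * L)) := by
    have h2 : ((⌊K * L⌋₊ : ℕ) + 2 : ℝ) ≤ Real.exp (2 * Real.log L) := by
      rw [two_mul, Real.exp_add, Real.exp_log (by linarith)]
      have := Nat.floor_le (show 0 ≤ K * L by positivity)
      nlinarith
    calc ((⌊K * L⌋₊ : ℕ) + 2 : ℝ) ^ (v n ^ 2) ≤ (Real.exp (2 * Real.log L)) ^ (v n ^ 2) := by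
          gcongr
      _ = Real.exp ((v n : ℝ) ^ 2 * (2 * Real.log L)) := by
          rw [← Real.exp_nat_mul]; push_cast; rfl
      _ ≤ Real.exp ((1 / 8 * n * η * (L / Real.log L)) * (2 * Real.log L)) := by
          apply Real.exp_le_exp.mpr
          gcongr
      _ = _ := by
          congr 1
          field_simp
          ring
  have h2 : ((⌊δ * n⌋₊ + 2 * ⌊(c + 1) * n⌋₊ + 1 : ℕ) : ℝ) ^ n ≤
      Real.exp (n * (Real.log C + L)) := by
    rw [Real.exp_nat_mul, Real.exp_add, Real.exp_log hC0, Real.exp_log hn0]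
    gcongr
    have h3 := Nat.floor_le (show 0 ≤ δ * n by positivity)
    have h4 := Nat.floor_le (show 0 ≤ (c + 1) * n by positivity)
    push_cast
    rw [hC]
    nlinarith
  have h3 : ((n : ℝ) ^ 2 + 1) ^ ⌊δ * n / 2⌋₊ ≤ Real.exp (n * (δ / 2 * Real.log 2 + δ * L)) := by
    have h5 : (n : ℝ) ^ 2 + 1 ≤ Real.exp (Real.log 2 + 2 * L) := by
      rw [two_mul, Real.exp_add, Real.exp_add, Real.exp_log hn0, Real.exp_log two_pos]
      nlinarith
    calc ((n : ℝ) ^ 2 + 1) ^ ⌊δ * n / 2⌋₊ ≤ (Real.exp (Real.log 2 + 2 * L)) ^ ⌊δ * n / 2⌋₊ := by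
          gcongr
      _ = Real.exp (⌊δ * n / 2⌋₊ * (Real.log 2 + 2 * L)) := by rw [← Real.exp_nat_mul]
      _ ≤ Real.exp (δ * n / 2 * (Real.log 2 + 2 * L)) := by
          apply Real.exp_le_exp.mpr
          have h6 := Nat.floor_le (show 0 ≤ δ * n / 2 by positivity)
          have h7 : 0 ≤ Real.log 2 + 2 * L := by
            have := Real.log_pos one_lt_two
            linarith
          gcongr
      _ = _ := by congr 1; ring
  calc _ ≤ Real.exp (n * (η / 4 * L)) * (Real.exp (n * (Real.log C + L)) *
        Real.exp (n * (δ / 2 * Real.log 2 + δ * L))) *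
        Real.exp (-((c / 2 - η / 4) * n * (L - Real.log c))) := by gcongr
    _ = Real.exp (n * (B - η / 2 * L)) := by
        rw [← Real.exp_add, ← Real.exp_add, ← Real.exp_add]
        congr 1
        rw [hB, hη]
        ring
    _ ≤ _ := by
        apply Real.exp_le_exp.mpr
        have h8 : B + 1 ≤ η / 2 * L := by
          calc B + 1 = η / 2 * (2 / η * (B + 1)) := by field_simp
            _ ≤ _ := by gcongr
        nlinarith

/-- The substantial case `δ ≥ 0` of the theorem, in terms of the complementary event. -/
theorem tendsto_real_reconstructionError_le {c δ : ℝ} (hδ0 : 0 ≤ δ) (hδ : δ < 0.5 * c - 1)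
    (V : ∀ n : ℕ, Finset (Fin n)) (Ghat : ∀ n : ℕ, Estimator (V n))
    (hV : ∀ᶠ n : ℕ in atTop, ((V n).card : ℝ) ^ 2 <
      1 / 8 * n * (0.5 * c - δ - 1) * (Real.log n / Real.log (Real.log n))) :
    Tendsto (fun n : ℕ => (sparseRandomGraph c n).real
      {G | reconstructionError (V n) (Ghat n) G ≤ δ * n}) atTop (𝓝 0) := by
  have hc2 : 2 < c := by norm_num at hδ; linarith
  have hc : 0 < c := by linarith
  set η := 0.5 * c - δ - 1 with hη
  have hη0 : 0 < η := by linarith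
  obtain ⟨K, hK, hdist⟩ := exists_tendsto_edist_le_log hc2
  have hlow := tendsto_real_edges_lt hc (show 0 < η / 4 by positivity)
  have hhigh := tendsto_real_lt_edges hc
  have hexp : Tendsto (fun n : ℕ => Real.exp (-(n : ℝ))) atTop (𝓝 0) :=
    Real.tendsto_exp_atBot.comp (tendsto_neg_atTop_atBot.comp tendsto_natCast_atTop_atTop)
  have hlim := ((hdist.add hlow).add hhigh).add hexp
  simp only [add_zero] at hlim
  refine tendsto_of_tendsto_of_tendsto_of_le_of_le' tendsto_const_nhds hlim
    (Eventually.of_forall fun n => measureReal_nonneg) ?_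
  filter_upwards [eventually_count_mul_exp_le hc hδ0 hK hη hη0 (fun n => (V n).card) hV,
    eventually_ge_atTop ⌈c⌉₊] with n hcount hnc'
  have hnc : c ≤ n := (Nat.le_ceil c).trans (by exact_mod_cast hnc')
  have hgood := (real_reconstructed_le hc hnc (V n) (Ghat n) (show 0 ≤ δ * n by positivity)
    ⌊K * Real.log n⌋₊ ⌊(c + 1) * n⌋₊ ((c / 2 - η / 4) * n)).trans hcount
  refine le_trans ?_ (add_le_add_right hgood _)
  refine le_trans ?_ (add_le_add_left (add_le_add_left (measureReal_union_le _ _) _) _)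
  refine le_trans ?_ (add_le_add_left (measureReal_union_le _ _) _)
  refine le_trans ?_ (measureReal_union_le _ _)
  refine measureReal_mono ?_ (measure_ne_top _ _)
  intro G hG
  by_cases h1 : ∀ x y, G.edist x y ≠ ⊤ → G.edist x y ≤ (⌊K * Real.log n⌋₊ : ℕ)
  · by_cases h2 : (G.edgeSet.ncard : ℝ) < (c / 2 - η / 4) * n
    · exact Or.inl (Or.inl (Or.inr h2))
    · by_cases h3 : (c + 1) * n < (G.edgeSet.ncard : ℝ)
      · exact Or.inl (Or.inr h3)
      · exact Or.inr ⟨h1, not_lt.mp h2, Nat.le_floor (not_lt.mp h3), hG⟩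
  · exact Or.inl (Or.inl (Or.inl h1))

end TopologyDiscovery

theorem theorem4 :
    ∃ M : ℝ, 0 < M ∧
      ∀ (c δ : ℝ), 0 < c → δ < 0.5 * c - 1 →
      ∀ (V : ∀ n : ℕ, Finset (Fin n)) (Ghat : ∀ n : ℕ, TopologyDiscovery.Estimator (V n)),
        (∀ᶠ n : ℕ in atTop,
          ((V n).card : ℝ) ^ 2 <
            M * n * (0.5 * c - δ - 1) * (Real.log n / Real.log (Real.log n))) →
        Tendsto
          (fun n : ℕ => TopologyDiscovery.sparseRandomGraph c n
            {G | δ * n < TopologyDiscovery.reconstructionError (V n) (Ghat n) G})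
          atTop (𝓝 1) := by
  refine ⟨1 / 8, by norm_num, fun c δ hc hδ V Ghat hV => ?_⟩
  have hfail : Tendsto (fun n : ℕ => (TopologyDiscovery.sparseRandomGraph c n).real
      {G | TopologyDiscovery.reconstructionError (V n) (Ghat n) G ≤ δ * n}) atTop (𝓝 0) := by
    rcases lt_or_ge δ 0 with h0 | h0
    · refine tendsto_const_nhds.congr' ?_
      filter_upwards [eventually_ge_atTop 1] with n hn
      have hn' : (0 : ℝ) < n := by exact_mod_cast hn
      rw [show {G | TopologyDiscovery.reconstructionError (V n) (Ghat n) G ≤ δ * n} = ∅ from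
        Set.eq_empty_of_forall_notMem fun G hG => by
          have h1 := TopologyDiscovery.reconstructionError_nonneg (V n) (Ghat n) G
          have h2 : TopologyDiscovery.reconstructionError (V n) (Ghat n) G ≤ δ * n := hG
          nlinarith]
      simp
    · exact TopologyDiscovery.tendsto_real_reconstructionError_le h0 hδ V Ghat hV
  have hlim : Tendsto (fun n : ℕ => (1 : ENNReal) - ENNReal.ofReal
      ((TopologyDiscovery.sparseRandomGraph c n).real
        {G | TopologyDiscovery.reconstructionError (V n) (Ghat n) G ≤ δ * n})) atTop (𝓝 1) := by
    have h1 := ENNReal.Tendsto.sub (tendsto_const_nhds (x := (1 : ENNReal)))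
      (ENNReal.tendsto_ofReal hfail) (Or.inl ENNReal.one_ne_top)
    simpa using h1
  refine tendsto_of_tendsto_of_tendsto_of_le_of_le hlim tendsto_const_nhds (fun n => ?_)
    (fun n => prob_le_one)
  rw [tsub_le_iff_right, ofReal_measureReal (measure_ne_top _ _)]
  calc (1 : ENNReal) = TopologyDiscovery.sparseRandomGraph c n Set.univ := measure_univ.symm
    _ ≤ TopologyDiscovery.sparseRandomGraph c n
        ({G | δ * n < TopologyDiscovery.reconstructionError (V n) (Ghat n) G} ∪
        {G | TopologyDiscovery.reconstructionError (V n) (Ghat n) G ≤ δ * n}) :=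
      measure_mono fun G _ =>
        (lt_or_ge (δ * n) (TopologyDiscovery.reconstructionError (V n) (Ghat n) G)).imp id id
    _ ≤ _ := measure_union_le _ _
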